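/- Let $n\ge 1$, $0<p<\infty$, $0<q\le\infty$ and $0<r<\min\{p,q\}$. For a function $\phi:\mathbb R^n\times(0,\infty)\to(0,\infty)$ and a measurable function $f$ on $\mathbb R^n$ put $$\|f\|_{\mathcal M_{p,\phi}}=\sup_{Q}\frac1{\phi(c(Q),\ell(Q))}\Big(\frac1{|Q|}\int_Q|f(y)|^p\,dy\Big)^{1/p}\in[0,\infty],$$ where $Q$ runs over all compact cubes with sides parallel to the axes, with centre $c(Q)$ and side length $\ell(Q)$. Let $\phi_1,\phi_2:\mathbb R^n\times(0,\infty)\to(0,\infty)$ be functions for which there is a constant $K$ with $$\sup_{\tau>t}\Big[\Big(\inf_{\tau<s<\infty}\phi_1(x,s)\,s^{n/p}\Big)\tau^{-n/p}\Big]\le K\,\phi_2(x,t)\qquad(x\in\mathbb R^n,\ t>0).$$ Let $\{\Omega_j\}_{j\ge0}$ be a sequence of compact subsets of $\mathbb R^n$, and let $d_j$ be the diameter of $\Omega_j$. Then there is a constant $C>0$ such that $$\left\|\left\{\left\|\sup_{y\in\mathbb R^n}\frac{|f_j(\cdot-y)|}{1+|d_jy|^{n/r}}\right\|_{\mathcal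 M_{p,\phi_2}}\right\}_{j\ge0}\right\|_{\ell_q}\le C\left\|\left\{\|f_j\|_{\mathcal M_{p,\phi_1}}\right\}_{j\ge0}\right\|_{\ell_q}$$ for every sequence $\{f_j\}_{j\ge0}$ of complex-valued measurable functions on $\mathbb R^n$ that are tempered distributions (that is, $\int\psi f_j$ converges absolutely for every Schwartz function $\psi$ and is a continuous functional of $\psi$) with $\operatorname{supp}\mathcal F f_j\subset\Omega_j$, where $\mathcal F$ is the distributional Fourier transform. Here each $f_j$ agrees almost everywhere with a unique continuous function, and the supremum over $y$ is taken for that continuous representative. -/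

import Mathlib

open MeasureTheory
open scoped ENNReal SchwartzMap FourierTransform

/-- Euclidean space `ℝⁿ`. -/
abbrev RSpace (n : ℕ) : Type := EuclideanSpace ℝ (Fin n)

/-- The compact cube with sides parallel to the axes, centre `c` and side length `ℓ`. -/
def axisCube {n : ℕ} (c : RSpace n) (ℓ : ℝ) : Set (RSpace n) :=
  {y | ∀ i, |y i - c i| ≤ ℓ / 2}

/-- The generalized Morrey (quasi-)norm of a nonnegative function `h`:
the supremum over all cubes `Q` of `φ(Q)⁻¹ (|Q|⁻¹ ∫_Q h ^ p) ^ (1 / p)`,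
where `φ(Q) = φ (centre of Q) (side length of Q)`. The norm of a complex-valued function `f` is
that of `‖f ·‖ₑ`; the value `∞` means that `f` is not in the space. -/
noncomputable def morreyNorm {n : ℕ} (p : ℝ) (φ : RSpace n → ℝ → ℝ) (h : RSpace n → ℝ≥0∞) :
    ℝ≥0∞ :=
  ⨆ (c : RSpace n) (ℓ : ℝ) (_ : 0 < ℓ),
    ((∫⁻ y in axisCube c ℓ, h y ^ p) / volume (axisCube c ℓ)) ^ (1 / p) / ENNReal.ofReal (φ c ℓ)

/-- The `ℓ_q` (quasi-)norm of a sequence of nonnegative extended reals, `0 < q ≤ ∞`. -/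
noncomputable def littleLqNorm (q : ℝ≥0∞) (a : ℕ → ℝ≥0∞) : ℝ≥0∞ :=
  if q = ∞ then ⨆ j, a j else (∑' j, a j ^ q.toReal) ^ (1 / q.toReal)

/-- The compatibility condition on the pair `(φ₁, φ₂)`:
`sup_{τ > t} (inf_{s > τ} φ₁(x, s) s^{n/p}) τ^{-n/p} ≤ K φ₂(x, t)`
for all `x` and all `t > 0`, with `K` independent of `x` and `t`. -/
def MorreyPairCondition (n : ℕ) (p : ℝ) (φ₁ φ₂ : RSpace n → ℝ → ℝ) : Prop :=
  ∃ K : ℝ, 0 < K ∧ ∀ (x : RSpace n) (t : ℝ), 0 < t →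
    (⨆ (τ : ℝ) (_ : t < τ),
      (⨅ (s : ℝ) (_ : τ < s), ENNReal.ofReal (φ₁ x s * s ^ ((n : ℝ) / p))) *
        ENNReal.ofReal (τ ^ (-((n : ℝ) / p)))) ≤ ENNReal.ofReal (K * φ₂ x t)

/-- The function `f` is the tempered distribution `T`: the integrals `∫ ψ f` converge absolutely
for all Schwartz functions `ψ` and `T ψ = ∫ ψ f`.
(This entails that `f` is a.e. strongly measurable and locally integrable.) -/
def RepresentsTempered {n : ℕ} (f : RSpace n → ℂ) (T : 𝓢'(RSpace n, ℂ)) : Prop :=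
  ∀ ψ : 𝓢(RSpace n, ℂ),
    Integrable (fun x => ψ x * f x) ∧ T ψ = ∫ x, ψ x * f x

/-- `f` is a tempered distribution whose (distributional) Fourier transform is supported
in `Ω`. -/
def FourierSupportedIn {n : ℕ} (f : RSpace n → ℂ) (Ω : Set (RSpace n)) : Prop :=
  ∃ T : 𝓢'(RSpace n, ℂ), RepresentsTempered f T ∧ Distribution.dsupport (𝓕 T : 𝓢'(RSpace n, ℂ)) ⊆ Ω

/-- The Peetre maximal function `x ↦ sup_y |f (x - y)| / (1 + |d y| ^ (n / r))`. -/
noncomputable def peetreMaximal {n : ℕ} (r d : ℝ) (f : RSpace n → ℂ) (x : RSpace n) : ℝ≥0∞ :=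
  ⨆ y : RSpace n, ‖f (x - y)‖ₑ / ENNReal.ofReal (1 + (d * ‖y‖) ^ ((n : ℝ) / r))

/-!
Let `d` be the diameter of `Ω` and `ε > d`, so that `Ω` lies in a ball of radius `ε`. If `χ` is a
bump function equal to `1` near that ball, then `f` agrees almost everywhere with the continuous
function `g = f * 𝓕⁻¹ χ` of polynomial growth, and `|g|` is dominated by `|g|` convolved with a
Schwartz kernel dilated to the scale `1 / ε`. Peetre's argument turns this into the pointwise bound
of `sup_y |g (x - y)| ^ p (1 + ε |y|) ^ (-n p / r)` by a multiple of
`εⁿ ∫ |g y| ^ p (1 + ε |x - y|) ^ (-n p / r) dy`. For `p > 1` this is Hölder's inequality. For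
`p ≤ 1` a factor `|g| ^ (1 - p)` is absorbed into the supremum; this needs the supremum to be
finite, which the polynomial growth of `g` gives for a large exponent in place of `n / r`, and the
estimate for the large exponent then gives for `n / r` itself.

Integrating over a cube and cutting the weight into dyadic shells leaves averages of `|g| ^ p` over
the larger concentric cubes; the shells sum up because `n < n p / r`. All these averages are
controlled by the same number `φ₂` of the original cube, which is what the condition on `(φ₁, φ₂)`
says. The constants do not depend on `ε`, so `ε` may decrease to `d`, even if `d = 0`.
-/

open Filter Topology

section SchwartzLimits

variable {E : Type*} [NormedAddCommGroup E] [NormedSpace ℝ E]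

lemma norm_iteratedFDeriv_comp_smul_sub_one_le {e : 𝓢(E, ℂ)} (he : e 0 = 1) {c : ℝ} (hc : |c| ≤ 1)
    (i : ℕ) (x : E) :
    ‖iteratedFDeriv ℝ i (fun y => e (c • y) - 1) x‖ ≤
      (SchwartzMap.seminorm ℝ 0 i e + SchwartzMap.seminorm ℝ 0 1 e) * (|c| * (1 + ‖x‖)) := by
  have hi := apply_nonneg (SchwartzMap.seminorm ℝ 0 i) e
  have h1 := apply_nonneg (SchwartzMap.seminorm ℝ 0 1) e
  rcases i with _ | i
  · have hfd (z : E) : ‖fderiv ℝ e z‖ ≤ SchwartzMap.seminorm ℝ 0 1 e := by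
      simpa only [norm_iteratedFDeriv_one] using e.norm_iteratedFDeriv_le_seminorm ℝ 1 z
    calc ‖iteratedFDeriv ℝ 0 (fun y => e (c • y) - 1) x‖
        = ‖e (c • x) - e 0‖ := by rw [norm_iteratedFDeriv_zero, he]
      _ ≤ SchwartzMap.seminorm ℝ 0 1 e * ‖c • x - 0‖ :=
          convex_univ.norm_image_sub_le_of_norm_fderiv_le (fun z _ => e.differentiableAt)
            (fun z _ => hfd z) trivial trivial
      _ ≤ _ := by
          rw [sub_zero, norm_smul, Real.norm_eq_abs]
          gcongr <;> linarith
  · have hderiv : iteratedFDeriv ℝ (i + 1) (fun y => e (c • y) - 1) x =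
        c ^ (i + 1) • iteratedFDeriv ℝ (i + 1) e (c • x) := by
      have he_smul : ContDiff ℝ (i + 1 : ℕ) fun y : E => e (c • y) :=
        (e.smooth _).comp (contDiff_const_smul c)
      rw [fun_iteratedFDeriv_sub_apply he_smul.contDiffAt contDiffAt_const,
        iteratedFDeriv_comp_const_smul c (e.smooth _), iteratedFDeriv_succ_const]
      exact sub_zero _
    rw [hderiv, norm_smul, norm_pow, Real.norm_eq_abs, mul_comm]
    gcongr
    · exact (e.norm_iteratedFDeriv_le_seminorm ℝ _ _).trans (by linarith)
    · calc |c| ^ (i + 1) ≤ |c| := pow_le_of_le_one (abs_nonneg c) hc i.succ_ne_zero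
        _ ≤ |c| * (1 + ‖x‖) := le_mul_of_one_le_right (abs_nonneg c) (by simp)

lemma norm_pow_mul_norm_iteratedFDeriv_mul_le {m : E → ℂ} (hm : ContDiff ℝ (⊤ : ℕ∞) m) {δ : ℝ}
    (hδ : 0 ≤ δ) {W : ℕ → ℝ} (hW : ∀ i, 0 ≤ W i)
    (hmW : ∀ i x, ‖iteratedFDeriv ℝ i m x‖ ≤ W i * (δ * (1 + ‖x‖)))
    (u : 𝓢(E, ℂ)) (k l : ℕ) (x : E) :
    ‖x‖ ^ k * ‖iteratedFDeriv ℝ l (fun y => m y * u y) x‖ ≤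
      δ * ∑ i ∈ Finset.range (l + 1), l.choose i * W i *
        (SchwartzMap.seminorm ℝ k (l - i) u + SchwartzMap.seminorm ℝ (k + 1) (l - i) u) := by
  calc ‖x‖ ^ k * ‖iteratedFDeriv ℝ l (fun y => m y * u y) x‖
      ≤ ‖x‖ ^ k * ∑ i ∈ Finset.range (l + 1), l.choose i * ‖iteratedFDeriv ℝ i m x‖ *
          ‖iteratedFDeriv ℝ (l - i) u x‖ := by
        gcongr
        exact norm_iteratedFDeriv_mul_le hm (u.smooth _) x (mod_cast le_top)
    _ ≤ ‖x‖ ^ k * ∑ i ∈ Finset.range (l + 1), l.choose i * (W i * (δ * (1 + ‖x‖))) *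
          ‖iteratedFDeriv ℝ (l - i) u x‖ := by
        gcongr
        exact hmW _ _
    _ = δ * ∑ i ∈ Finset.range (l + 1), l.choose i * W i *
          (‖x‖ ^ k * ‖iteratedFDeriv ℝ (l - i) u x‖ +
            ‖x‖ ^ (k + 1) * ‖iteratedFDeriv ℝ (l - i) u x‖) := by
        simp only [Finset.mul_sum]
        exact Finset.sum_congr rfl fun i _ => by ring
    _ ≤ _ := by
        gcongr with i
        · exact mul_nonneg (Nat.cast_nonneg _) (hW i)
        · exact u.le_seminorm ℝ _ _ x
        · exact u.le_seminorm ℝ _ _ x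

lemma tendsto_smulLeftCLM_comp_smul {e : 𝓢(E, ℂ)} (he : e 0 = 1) (u : 𝓢(E, ℂ)) :
    Tendsto (fun c : ℝ => SchwartzMap.smulLeftCLM ℂ (fun x => e (c • x)) u) (𝓝 0) (𝓝 u) := by
  have hbound (k l : ℕ) : ∃ C, ∀ c : ℝ, |c| ≤ 1 → SchwartzMap.seminorm ℝ k l
      (SchwartzMap.smulLeftCLM ℂ (fun x => e (c • x)) u - u) ≤ |c| * C := by
    let W (i : ℕ) : ℝ := SchwartzMap.seminorm ℝ 0 i e + SchwartzMap.seminorm ℝ 0 1 e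
    refine ⟨∑ i ∈ Finset.range (l + 1), l.choose i * W i *
      (SchwartzMap.seminorm ℝ k (l - i) u + SchwartzMap.seminorm ℝ (k + 1) (l - i) u),
      fun c hc => SchwartzMap.seminorm_le_bound ℝ k l _ (by positivity) fun x => ?_⟩
    have he_smul : (fun y : E => e (c • y)).HasTemperateGrowth :=
      e.hasTemperateGrowth.comp (by fun_prop)
    have hsub : ⇑(SchwartzMap.smulLeftCLM ℂ (fun x => e (c • x)) u - u) =
        fun y => (e (c • y) - 1) * u y := by
      ext y
      rw [sub_apply, SchwartzMap.smulLeftCLM_apply_apply he_smul, smul_eq_mul,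
        sub_one_mul]
    rw [hsub]
    exact norm_pow_mul_norm_iteratedFDeriv_mul_le (he_smul.1.sub contDiff_const) (abs_nonneg c)
      (fun i => by positivity) (norm_iteratedFDeriv_comp_smul_sub_one_le he hc) u k l x
  rw [(schwartz_withSeminorms ℝ E ℂ).tendsto_nhds]
  rintro ⟨k, l⟩ ε hε
  obtain ⟨C, hC⟩ := hbound k l
  have hlim : Tendsto (fun c : ℝ => |c| * C) (𝓝 0) (𝓝 0) := by
    simpa using (continuous_abs.tendsto (0 : ℝ)).mul_const C
  filter_upwards [hlim.eventually_lt_const hε, Metric.closedBall_mem_nhds (0 : ℝ) one_pos]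
    with c hcε hc1
  exact (hC c (by simpa using hc1)).trans_lt hcε

end SchwartzLimits

section Translation

variable {E F : Type*} [NormedAddCommGroup E] [NormedSpace ℝ E] [NormedAddCommGroup F]
  [NormedSpace ℝ F]

lemma iteratedFDeriv_compSubConstCLM (K : 𝓢(E, F)) (x : E) (l : ℕ) (y : E) :
    iteratedFDeriv ℝ l (SchwartzMap.compSubConstCLM ℝ x K) y = iteratedFDeriv ℝ l K (y - x) :=
  iteratedFDeriv_comp_sub l x y

lemma seminorm_compSubConstCLM_sub_le (K : 𝓢(E, F)) (k l : ℕ) {h : E} (hh : ‖h‖ ≤ 1) :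
    SchwartzMap.seminorm ℝ k l (SchwartzMap.compSubConstCLM ℝ h K - K) ≤
      (2 ^ k * (Finset.Iic (k, l + 1)).sup (fun m => SchwartzMap.seminorm ℝ m.1 m.2) K) * ‖h‖ := by
  refine SchwartzMap.seminorm_le_bound ℝ k l _ (by positivity) fun y => ?_
  have hsub : iteratedFDeriv ℝ l (SchwartzMap.compSubConstCLM ℝ h K - K : 𝓢(E, F)) y =
      iteratedFDeriv ℝ l K (y - h) - iteratedFDeriv ℝ l K y := by
    rw [← iteratedFDeriv_compSubConstCLM]
    exact iteratedFDeriv_sub_apply ((SchwartzMap.smooth _ _).contDiffAt)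
      ((K.smooth _).contDiffAt)
  have hderiv (z : E) (hz : z ∈ Metric.closedBall y ‖h‖) :
      ‖y‖ ^ k * ‖fderiv ℝ (iteratedFDeriv ℝ l K) z‖ ≤
        2 ^ k * (Finset.Iic (k, l + 1)).sup (fun m => SchwartzMap.seminorm ℝ m.1 m.2) K := by
    have hyz : ‖y‖ ≤ 1 + ‖z‖ := by
      rw [mem_closedBall_iff_norm'] at hz
      linarith [norm_le_norm_sub_add y z]
    rw [norm_fderiv_iteratedFDeriv]
    refine le_trans ?_ (SchwartzMap.one_add_le_sup_seminorm_apply (𝕜 := ℝ) (m := (k, l + 1)) le_rfl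
      le_rfl K z)
    gcongr
  have hdiff : Differentiable ℝ (iteratedFDeriv ℝ l K) :=
    (K.smooth ⊤).differentiable_iteratedFDeriv (mod_cast WithTop.coe_lt_top l)
  calc ‖y‖ ^ k * ‖iteratedFDeriv ℝ l (SchwartzMap.compSubConstCLM ℝ h K - K : 𝓢(E, F)) y‖
      = ‖‖y‖ ^ k • iteratedFDeriv ℝ l K (y - h) - ‖y‖ ^ k • iteratedFDeriv ℝ l K y‖ := by
        rw [hsub, ← smul_sub, norm_smul, norm_pow, norm_norm]
    _ ≤ _ * ‖y - h - y‖ :=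
        (convex_closedBall y ‖h‖).norm_image_sub_le_of_norm_hasFDerivWithin_le
          (fun z _ => ((hdiff z).hasFDerivAt.const_smul (‖y‖ ^ k)).hasFDerivWithinAt)
          (fun z hz => by
            rw [norm_smul, norm_pow, norm_norm]
            exact hderiv z hz)
          (Metric.mem_closedBall_self (norm_nonneg h)) (by simp)
    _ = _ := by rw [sub_sub_cancel_left, norm_neg]

lemma continuous_compSubConstCLM (K : 𝓢(E, F)) :
    Continuous fun x : E => SchwartzMap.compSubConstCLM ℝ x K := by
  have hzero : Tendsto (fun h : E => SchwartzMap.compSubConstCLM ℝ h K) (𝓝 0) (𝓝 K) := by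
    rw [(schwartz_withSeminorms ℝ E F).tendsto_nhds]
    rintro ⟨k, l⟩ ε hε
    have hlim := (continuous_norm (E := E)).tendsto' 0 0 norm_zero |>.const_mul
      (2 ^ k * (Finset.Iic (k, l + 1)).sup (fun m => SchwartzMap.seminorm ℝ m.1 m.2) K)
    rw [mul_zero] at hlim
    filter_upwards [hlim.eventually_lt_const hε, Metric.closedBall_mem_nhds (0 : E) one_pos]
      with h hhε hh1
    exact (seminorm_compSubConstCLM_sub_le K k l (by simpa using hh1)).trans_lt hhε
  refine continuous_iff_continuousAt.2 fun x => ?_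
  have hx := ((SchwartzMap.compSubConstCLM ℝ x).continuous.tendsto K).comp
    (hzero.comp ((continuous_sub_right x).tendsto' x 0 (sub_self x)))
  refine hx.congr fun z => ?_
  simp

lemma seminorm_compSubConstCLM_le (K : 𝓢(E, F)) (k l : ℕ) (x : E) :
    SchwartzMap.seminorm ℝ k l (SchwartzMap.compSubConstCLM ℝ x K) ≤
      (2 ^ k * (Finset.Iic (k, l)).sup (fun m => SchwartzMap.seminorm ℝ m.1 m.2) K) *
        (1 + ‖x‖) ^ k := by
  refine SchwartzMap.seminorm_le_bound ℝ k l _ (by positivity) fun y => ?_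
  have hy : ‖y‖ ≤ (1 + ‖y - x‖) * (1 + ‖x‖) := by
    nlinarith [norm_le_norm_sub_add y x, norm_nonneg (y - x), norm_nonneg x]
  rw [iteratedFDeriv_compSubConstCLM]
  calc ‖y‖ ^ k * ‖iteratedFDeriv ℝ l K (y - x)‖
      ≤ ((1 + ‖y - x‖) * (1 + ‖x‖)) ^ k * ‖iteratedFDeriv ℝ l K (y - x)‖ := by gcongr
    _ = ((1 + ‖y - x‖) ^ k * ‖iteratedFDeriv ℝ l K (y - x)‖) * (1 + ‖x‖) ^ k := by
        rw [mul_pow, mul_right_comm]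
    _ ≤ _ := mul_le_mul_of_nonneg_right (SchwartzMap.one_add_le_sup_seminorm_apply (𝕜 := ℝ)
        (m := (k, l)) le_rfl le_rfl K _) (by positivity)

lemma exists_norm_apply_compSubConstCLM_le (T : 𝓢'(E, ℂ)) (K : 𝓢(E, ℂ)) :
    ∃ C M : ℝ, 0 ≤ C ∧
      ∀ x, ‖T (SchwartzMap.compSubConstCLM ℝ x K)‖ ≤ C * (1 + ‖x‖) ^ M := by
  obtain ⟨s, B, -, hB⟩ := Seminorm.bound_of_continuous (schwartz_withSeminorms ℂ E ℂ)
    ((normSeminorm ℂ ℂ).comp T.toLinearMap) (continuous_norm.comp T.continuous)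
  let A (m : ℕ × ℕ) : ℝ :=
    2 ^ m.1 * (Finset.Iic m).sup (fun m => SchwartzMap.seminorm ℝ m.1 m.2) K
  let N := s.sup Prod.fst
  refine ⟨B * ∑ m ∈ s, A m, N, by positivity, fun x => ?_⟩
  calc ‖T (SchwartzMap.compSubConstCLM ℝ x K)‖
      ≤ B * s.sup (schwartzSeminormFamily ℂ E ℂ) (SchwartzMap.compSubConstCLM ℝ x K) := hB _
    _ ≤ B * ((∑ m ∈ s, A m) * (1 + ‖x‖) ^ N) := by
        gcongr
        refine Seminorm.finset_sup_apply_le (by positivity) fun m hm => ?_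
        refine (seminorm_compSubConstCLM_le K m.1 m.2 x).trans ?_
        gcongr
        · exact Finset.single_le_sum (f := A) (fun m _ => by positivity) hm
        · linarith [norm_nonneg x]
        · exact Finset.le_sup (f := Prod.fst) hm
    _ = _ := by rw [mul_assoc, Real.rpow_natCast]

end Translation

section Support

variable {E : Type*} [NormedAddCommGroup E] [InnerProductSpace ℝ E] [FiniteDimensional ℝ E]

/-- A smooth bump function, regarded as a complex-valued Schwartz function. -/
noncomputable def schwartzBump {c : E} (B : ContDiffBump c) : 𝓢(E, ℂ) :=
  (B.hasCompactSupport.comp_left (g := ((↑) : ℝ → ℂ)) Complex.ofReal_zero).toSchwartzMap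
    (Complex.ofRealCLM.contDiff.comp B.contDiff)

lemma schwartzBump_apply {c : E} (B : ContDiffBump c) (x : E) : schwartzBump B x = (B x : ℂ) := rfl

lemma hasCompactSupport_schwartzBump {c : E} (B : ContDiffBump c) :
    HasCompactSupport (schwartzBump B) :=
  B.hasCompactSupport.comp_left Complex.ofReal_zero

open scoped Manifold ContDiff in
lemma apply_eq_zero_of_hasCompactSupport_of_disjoint_dsupport (T : 𝓢'(E, ℂ)) {u : 𝓢(E, ℂ)}
    (hu : HasCompactSupport u) (hTu : Disjoint (tsupport u) (Distribution.dsupport T)) :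
    T u = 0 := by
  have hcover (x : tsupport u) : ∃ V, Distribution.IsVanishingOn T V ∧ IsOpen V ∧ (x : E) ∈ V :=
    (Distribution.notMem_dsupport_iff _).1 (Set.disjoint_left.1 hTu x.2)
  choose V hTV hV hxV using hcover
  obtain ⟨t, ht⟩ := IsCompact.elim_finite_subcover hu V hV
    fun x hx => Set.mem_iUnion.2 ⟨⟨x, hx⟩, hxV ⟨x, hx⟩⟩
  obtain ⟨ρ, hρ⟩ := SmoothPartitionOfUnity.exists_isSubordinate 𝓘(ℝ, E) (isClosed_tsupport u)
    (fun i : t => V i) (fun i => hV i) (by rwa [Set.iUnion_subtype])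
  have hcs (i : t) : HasCompactSupport fun x => (ρ i x : ℂ) * u x := hu.mul_left
  let w (i : t) : 𝓢(E, ℂ) := (hcs i).toSchwartzMap
    ((Complex.ofRealCLM.contDiff.comp (ρ i).contMDiff.contDiff).mul (u.smooth ⊤))
  have hu_eq : u = ∑ i, w i := by
    ext x
    rw [sum_apply]
    change u x = ∑ i, (ρ i x : ℂ) * u x
    by_cases hx : x ∈ tsupport u
    · rw [← Finset.sum_mul, ← Complex.ofReal_sum, ← finsum_eq_sum_of_fintype, ρ.sum_eq_one hx,
        Complex.ofReal_one, one_mul]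
    · simp [image_eq_zero_of_notMem_tsupport hx]
  have hw (i : t) : T (w i) = 0 := by
    have hsub : tsupport (w i) ⊆ tsupport fun x => (ρ i x : ℂ) := tsupport_mul_subset_left
    exact hTV i _ ((hsub.trans (tsupport_comp_subset Complex.ofReal_zero _)).trans (hρ i))
  rw [hu_eq, map_sum]
  exact Finset.sum_eq_zero fun i _ => hw i

lemma apply_eq_zero_of_disjoint_dsupport (T : 𝓢'(E, ℂ)) {u : 𝓢(E, ℂ)}
    (hTu : Disjoint (tsupport u) (Distribution.dsupport T)) : T u = 0 := by
  let B : ContDiffBump (0 : E) := ⟨1, 2, one_pos, one_lt_two⟩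
  have hB0 : schwartzBump B 0 = 1 := by
    rw [schwartzBump_apply, B.one_of_mem_closedBall (Metric.mem_closedBall_self zero_le_one),
      Complex.ofReal_one]
  have hlim := ((T.continuous.tendsto u).comp (tendsto_smulLeftCLM_comp_smul hB0 u)).mono_left
    (nhdsWithin_le_nhds (s := {0}ᶜ))
  refine tendsto_nhds_unique hlim (tendsto_const_nhds.congr' ?_)
  filter_upwards [self_mem_nhdsWithin] with c hc
  have hsub := SchwartzMap.tsupport_smulLeftCLM_subset (fun x => schwartzBump B (c • x)) u
  have hcs : HasCompactSupport fun x => schwartzBump B (c • x) :=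
    (hasCompactSupport_schwartzBump B).comp_smul hc
  exact (apply_eq_zero_of_hasCompactSupport_of_disjoint_dsupport T
    (hcs.of_isClosed_subset (isClosed_tsupport _) (hsub.trans Set.inter_subset_right))
    (hTu.mono_left (hsub.trans Set.inter_subset_left))).symm

end Support

section Bandlimited

/-- The modulus of the dilation `εⁿ Ψ(ε v)` of `Ψ`, which has the same integral as that of `Ψ`. -/
noncomputable def dilatedKernel {E : Type*} [NormedAddCommGroup E] [NormedSpace ℝ E]
    (Ψ : 𝓢(E, ℂ)) (ε : ℝ) (v : E) : ℝ≥0∞ :=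
  ENNReal.ofReal (ε ^ Module.finrank ℝ E * ‖Ψ (ε • v)‖)

variable {E : Type*} [NormedAddCommGroup E] [InnerProductSpace ℝ E] [FiniteDimensional ℝ E]

/-- The bump function centred at `c` and equal to `1` on the ball of radius `2 * ε`, obtained by
translating and dilating the one centred at `0` with `ε = 1`. -/
noncomputable def scaledBump (c : E) (ε : ℝ) (hε : 0 < ε) : ContDiffBump c :=
  ⟨2 * ε, 3 * ε, by positivity, by linarith⟩

lemma scaledBump_apply (c : E) {ε : ℝ} (hε : 0 < ε) (x : E) :
    scaledBump c ε hε x = scaledBump (0 : E) 1 one_pos (ε⁻¹ • (x - c)) := by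
  simp only [ContDiffBump.apply, scaledBump, mul_one, sub_zero, mul_inv, smul_smul,
    mul_div_mul_right _ _ hε.ne']

lemma schwartzBump_scaledBump_eq_one {c x : E} {ε : ℝ} (hε : 0 < ε)
    (hx : x ∈ Metric.ball c (2 * ε)) : schwartzBump (scaledBump c ε hε) x = 1 := by
  rw [schwartzBump_apply, ContDiffBump.one_of_mem_closedBall _ (Metric.ball_subset_closedBall hx),
    Complex.ofReal_one]

variable [MeasurableSpace E] [BorelSpace E]

lemma locallyIntegrable_of_integrable_schwartz_mul {μ : Measure E} {f : E → ℂ}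
    (hf : ∀ ψ : 𝓢(E, ℂ), Integrable (fun x => ψ x * f x) μ) : LocallyIntegrable f μ := by
  refine fun x => ⟨Metric.ball x (2 * 1), Metric.ball_mem_nhds x (by norm_num), ?_⟩
  refine ((hf (schwartzBump (scaledBump x 1 one_pos))).integrableOn).congr_fun (fun y hy => ?_)
    Metric.isOpen_ball.measurableSet
  simp only [schwartzBump_scaledBump_eq_one one_pos hy, one_mul]

lemma fourier_schwartzBump_scaledBump (ξ₀ : E) {ε : ℝ} (hε : 0 < ε) (v : E) :
    𝓕 (schwartzBump (scaledBump ξ₀ ε hε)) v =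
      (ε ^ Module.finrank ℝ E : ℝ) • Real.fourierChar (-inner ℝ ξ₀ v) •
        𝓕 (schwartzBump (scaledBump (0 : E) 1 one_pos)) (ε • v) := by
  let G (ξ : E) : ℂ :=
    Real.fourierChar (-inner ℝ ξ (ε • v)) • schwartzBump (scaledBump (0 : E) 1 one_pos) ξ
  have hG (ξ : E) : Real.fourierChar (-inner ℝ ξ v) • schwartzBump (scaledBump ξ₀ ε hε) ξ =
      Real.fourierChar (-inner ℝ ξ₀ v) • G (ε⁻¹ • (ξ - ξ₀)) := by
    rw [schwartzBump_apply, scaledBump_apply, ← schwartzBump_apply, ← mul_smul,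
      ← AddChar.map_add_eq_mul, real_inner_smul_left, real_inner_smul_right,
      inv_mul_cancel_left₀ hε.ne', inner_sub_left]
    ring_nf
  rw [SchwartzMap.fourier_coe, SchwartzMap.fourier_coe, Real.fourier_eq, Real.fourier_eq]
  calc ∫ ξ, Real.fourierChar (-inner ℝ ξ v) • schwartzBump (scaledBump ξ₀ ε hε) ξ
      = ∫ ξ, Real.fourierChar (-inner ℝ ξ₀ v) • G (ε⁻¹ • (ξ - ξ₀)) := by simp only [hG]
    _ = ∫ ξ, Real.fourierChar (-inner ℝ ξ₀ v) • G (ε⁻¹ • ξ) :=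
        integral_sub_right_eq_self (fun ξ => Real.fourierChar (-inner ℝ ξ₀ v) • G (ε⁻¹ • ξ)) ξ₀
    _ = _ := by
        simp only [Circle.smul_def, G]
        rw [integral_smul, Measure.integral_comp_inv_smul_of_nonneg _
          (fun ξ => (Real.fourierChar (-inner ℝ ξ (ε • v)) : ℂ) •
            schwartzBump (scaledBump (0 : E) 1 one_pos) ξ) hε.le, smul_comm]

/-- The Schwartz function of integral one supported in the ball of radius `3 * ε` with which a
locally integrable function is mollified at scale `ε`. -/
noncomputable def mollifier (E : Type*) [NormedAddCommGroup E] [InnerProductSpace ℝ E]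
    [FiniteDimensional ℝ E] [MeasurableSpace E] [BorelSpace E] (ε : ℝ) (hε : 0 < ε) : 𝓢(E, ℂ) :=
  ((∫ x, scaledBump (0 : E) ε hε x : ℝ) : ℂ)⁻¹ • schwartzBump (scaledBump 0 ε hε)

lemma mollifier_apply {ε : ℝ} (hε : 0 < ε) (x : E) :
    mollifier E ε hε x = ((scaledBump (0 : E) ε hε).normed volume x : ℂ) := by
  rw [mollifier, smul_apply, schwartzBump_apply, smul_eq_mul, ContDiffBump.normed,
    Complex.ofReal_div, inv_mul_eq_div]

lemma fourierInv_mollifier_zero {ε : ℝ} (hε : 0 < ε) : 𝓕⁻ (mollifier E ε hε) 0 = 1 := by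
  simp only [SchwartzMap.fourierInv_coe, Real.fourierInv_eq, inner_zero_right,
    AddChar.map_zero_eq_one, one_smul, mollifier_apply]
  rw [integral_complex_ofReal, ContDiffBump.integral_normed, Complex.ofReal_one]

lemma fourierInv_mollifier {ε : ℝ} (hε : 0 < ε) (v : E) :
    𝓕⁻ (mollifier E ε hε) v = 𝓕⁻ (mollifier E 1 one_pos) (ε • v) := by
  have hscale {δ : ℝ} (hδ : 0 < δ) : ∃ A : ℂ, ∀ w : E, 𝓕⁻ (mollifier E δ hδ) w =
      A * 𝓕 (schwartzBump (scaledBump (0 : E) 1 one_pos)) (δ • -w) := by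
    refine ⟨((∫ x, scaledBump (0 : E) δ hδ x : ℝ) : ℂ)⁻¹ * (δ ^ Module.finrank ℝ E : ℝ),
      fun w => ?_⟩
    rw [SchwartzMap.fourierInv_coe, Real.fourierInv_eq_fourier_neg, ← SchwartzMap.fourier_coe,
      mollifier, FourierTransform.fourier_smul, smul_apply,
      fourier_schwartzBump_scaledBump, inner_zero_left, neg_zero, AddChar.map_zero_eq_one, one_smul,
      smul_eq_mul, Complex.real_smul, mul_assoc]
  obtain ⟨A, hA⟩ := hscale hε
  obtain ⟨A₁, hA₁⟩ := hscale one_pos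
  have hone := (hA 0).symm.trans (fourierInv_mollifier_zero hε)
  have hone₁ := (hA₁ 0).symm.trans (fourierInv_mollifier_zero one_pos)
  rw [neg_zero, smul_zero] at hone hone₁
  have hAA₁ : A = A₁ := mul_right_cancel₀ (right_ne_zero_of_mul_eq_one hone) (hone.trans hone₁.symm)
  rw [hA, hA₁, hAA₁, one_smul, smul_neg]

lemma ae_tendsto_integral_mollifier_mul {f : E → ℂ} (hf : LocallyIntegrable f) {ε : ℕ → ℝ}
    (hε : ∀ i, 0 < ε i) (hε0 : Tendsto ε atTop (𝓝 0)) :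
    ∀ᵐ x, Tendsto (fun i => ∫ y, mollifier E (ε i) (hε i) (y - x) * f y) atTop (𝓝 (f x)) := by
  have hrOut : Tendsto (fun i => (scaledBump (0 : E) (ε i) (hε i)).rOut) atTop (𝓝 0) := by
    simpa only [scaledBump, mul_zero] using hε0.const_mul 3
  have hratio (i : ℕ) : (scaledBump (0 : E) (ε i) (hε i)).rOut ≤
      2 * (scaledBump (0 : E) (ε i) (hε i)).rIn := by
    simp only [scaledBump]
    linarith [hε i]
  filter_upwards [ContDiffBump.ae_convolution_tendsto_right_of_locallyIntegrable hrOut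
    (.of_forall hratio) hf] with x hx
  refine hx.congr fun i => ?_
  rw [convolution_eq_swap]
  refine integral_congr_ae (.of_forall fun y => ?_)
  simp only [mollifier_apply, ContinuousLinearMap.lsmul_apply, Complex.real_smul]
  rw [← ContDiffBump.normed_neg, neg_sub]

lemma fourierInv_compSubConstCLM_fourier_apply (χ : 𝓢(E, ℂ)) (x v : E) :
    𝓕⁻ (SchwartzMap.compSubConstCLM ℝ x (𝓕 χ)) v = Real.fourierChar (inner ℝ x v) • χ v := by
  have hshift := congrFun (VectorFourier.fourierIntegral_comp_add_right Real.fourierChar volume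
    (innerₗ E) (𝓕 χ : 𝓢(E, ℂ)) (-x)) (-v)
  have hχ : VectorFourier.fourierIntegral Real.fourierChar volume (innerₗ E)
      (𝓕 χ : 𝓢(E, ℂ)) (-v) = χ v := by
    change 𝓕 ⇑(𝓕 χ : 𝓢(E, ℂ)) (-v) = χ v
    rw [← Real.fourierInv_eq_fourier_neg, ← SchwartzMap.fourierInv_coe,
      FourierTransform.fourierInv_fourier_eq]
  rw [hχ, innerₗ_apply_apply, inner_neg_neg] at hshift
  rw [SchwartzMap.fourierInv_coe, Real.fourierInv_eq_fourier_neg, ← hshift]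
  simp only [← sub_eq_add_neg]
  rfl

lemma apply_translate_fourier_eq_of_eqOn (T : 𝓢'(E, ℂ)) {U : Set E} (hU : IsOpen U)
    (hTU : Distribution.dsupport (𝓕 T : 𝓢'(E, ℂ)) ⊆ U) {χ η : 𝓢(E, ℂ)} (hχη : Set.EqOn χ η U)
    (x : E) :
    T (SchwartzMap.compSubConstCLM ℝ x (𝓕 χ)) = T (SchwartzMap.compSubConstCLM ℝ x (𝓕 η)) := by
  rw [← sub_eq_zero, ← map_sub, ← map_sub, ← FourierTransform.fourierCLM_apply (R := ℂ),
    ← FourierTransform.fourierCLM_apply (R := ℂ), ← map_sub, FourierTransform.fourierCLM_apply]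
  set w := SchwartzMap.compSubConstCLM ℝ x (𝓕 (χ - η))
  have hw : tsupport (𝓕⁻ w : 𝓢(E, ℂ)) ⊆ Uᶜ := by
    refine closure_minimal (fun ξ hξ hξU => hξ ?_) hU.isClosed_compl
    rw [fourierInv_compSubConstCLM_fourier_apply, sub_apply, hχη hξU, sub_self, smul_zero]
  have hzero : (𝓕 T : 𝓢'(E, ℂ)) (𝓕⁻ w) = 0 :=
    apply_eq_zero_of_disjoint_dsupport _
      (Set.disjoint_left.2 fun ξ hξw hξT => hw hξw (hTU hξT))
  rwa [TemperedDistribution.fourier_apply, FourierTransform.fourier_fourierInv_eq] at hzero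

lemma tendsto_apply_translate_mollifier (T : 𝓢'(E, ℂ)) {U : Set E} (hU : IsOpen U)
    (hTU : Distribution.dsupport (𝓕 T : 𝓢'(E, ℂ)) ⊆ U) {χ : 𝓢(E, ℂ)} (hχ : ∀ ξ ∈ U, χ ξ = 1)
    {ε : ℕ → ℝ} (hε : ∀ i, 0 < ε i) (hε0 : Tendsto ε atTop (𝓝 0)) (x : E) :
    Tendsto (fun i => T (SchwartzMap.compSubConstCLM ℝ x (mollifier E (ε i) (hε i)))) atTop
      (𝓝 (T (SchwartzMap.compSubConstCLM ℝ x (𝓕 χ)))) := by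
  let e : 𝓢(E, ℂ) := 𝓕⁻ (mollifier E 1 one_pos)
  have hlim : Tendsto (fun i => SchwartzMap.smulLeftCLM ℂ (fun ξ => e (ε i • ξ)) χ) atTop (𝓝 χ) :=
    (tendsto_smulLeftCLM_comp_smul (fourierInv_mollifier_zero one_pos) χ).comp hε0
  have hcont : Continuous fun η : 𝓢(E, ℂ) => T (SchwartzMap.compSubConstCLM ℝ x (𝓕 η)) :=
    T.continuous.comp ((SchwartzMap.compSubConstCLM ℝ x).continuous.comp
      (FourierTransform.fourierCLM ℂ 𝓢(E, ℂ)).continuous)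
  refine ((hcont.tendsto χ).comp hlim).congr fun i => ?_
  rw [← FourierTransform.fourier_fourierInv_eq (F := 𝓢(E, ℂ)) (mollifier E (ε i) (hε i))]
  refine apply_translate_fourier_eq_of_eqOn T hU hTU (fun ξ hξ => ?_) x
  have he : (fun ξ => e (ε i • ξ)).HasTemperateGrowth := e.hasTemperateGrowth.comp (by fun_prop)
  exact (SchwartzMap.smulLeftCLM_apply_apply he χ ξ).trans
    (by rw [hχ ξ hξ, smul_eq_mul, mul_one, fourierInv_mollifier (hε i)])

lemma ae_eq_apply_translate_fourier {f : E → ℂ} {T : 𝓢'(E, ℂ)}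
    (hf : ∀ ψ : 𝓢(E, ℂ), Integrable (fun x => ψ x * f x) ∧ T ψ = ∫ x, ψ x * f x)
    {U : Set E} (hU : IsOpen U) (hTU : Distribution.dsupport (𝓕 T : 𝓢'(E, ℂ)) ⊆ U)
    {χ : 𝓢(E, ℂ)} (hχ : ∀ ξ ∈ U, χ ξ = 1) :
    (fun x => T (SchwartzMap.compSubConstCLM ℝ x (𝓕 χ))) =ᵐ[volume] f := by
  have hε (i : ℕ) : 0 < 1 / ((i : ℝ) + 1) := by positivity
  have hε0 := tendsto_one_div_add_atTop_nhds_zero_nat (𝕜 := ℝ)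
  filter_upwards [ae_tendsto_integral_mollifier_mul
    (locallyIntegrable_of_integrable_schwartz_mul fun ψ => (hf ψ).1) hε hε0] with x hx
  refine tendsto_nhds_unique (tendsto_apply_translate_mollifier T hU hTU hχ hε hε0 x) ?_
  simpa only [(hf _).2, SchwartzMap.compSubConstCLM_apply] using hx

theorem exists_continuous_representative {f : E → ℂ} {T : 𝓢'(E, ℂ)} {Ω : Set E}
    (hΩ : Bornology.IsBounded Ω)
    (hf : ∀ ψ : 𝓢(E, ℂ), Integrable (fun x => ψ x * f x) ∧ T ψ = ∫ x, ψ x * f x)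
    (hTΩ : Distribution.dsupport (𝓕 T : 𝓢'(E, ℂ)) ⊆ Ω) :
    ∃ g : E → ℂ, Continuous g ∧ g =ᵐ[volume] f ∧
      (∃ C M : ℝ, 0 ≤ C ∧ ∀ x, ‖g x‖ ≤ C * (1 + ‖x‖) ^ M) ∧
      ∀ (ξ₀ : E) (ε : ℝ), 0 < ε → Ω ⊆ Metric.closedBall ξ₀ ε → ∀ x,
        ‖g x‖ₑ ≤ ∫⁻ y, ‖g y‖ₑ *
          dilatedKernel (𝓕 (schwartzBump (scaledBump (0 : E) 1 one_pos))) ε (y - x) := by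
  obtain ⟨R, hR, hΩR⟩ := hΩ.subset_closedBall_lt 0 0
  let g (ξ₀ : E) (ε : ℝ) (hε : 0 < ε) (x : E) : ℂ :=
    T (SchwartzMap.compSubConstCLM ℝ x (𝓕 (schwartzBump (scaledBump ξ₀ ε hε))))
  have hcont (ξ₀ : E) (ε : ℝ) (hε : 0 < ε) : Continuous (g ξ₀ ε hε) :=
    T.continuous.comp (continuous_compSubConstCLM _)
  have hae (ξ₀ : E) (ε : ℝ) (hε : 0 < ε) (hΩε : Ω ⊆ Metric.closedBall ξ₀ ε) :
      g ξ₀ ε hε =ᵐ[volume] f :=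
    ae_eq_apply_translate_fourier hf Metric.isOpen_ball
      ((hTΩ.trans hΩε).trans (Metric.closedBall_subset_ball (by linarith)))
      fun ξ hξ => schwartzBump_scaledBump_eq_one hε hξ
  have hgf := hae 0 R hR hΩR
  refine ⟨g 0 R hR, hcont 0 R hR, hgf, exists_norm_apply_compSubConstCLM_le T _,
    fun ξ₀ ε hε hΩε x => ?_⟩
  have hgg : g 0 R hR = g ξ₀ ε hε := (Continuous.ae_eq_iff_eq volume (hcont 0 R hR)
    (hcont ξ₀ ε hε)).1 (hgf.trans (hae ξ₀ ε hε hΩε).symm)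
  calc ‖g 0 R hR x‖ₑ
      = ‖∫ y, 𝓕 (schwartzBump (scaledBump ξ₀ ε hε)) (y - x) * f y‖ₑ := by
        rw [hgg]
        simp only [g, (hf _).2, SchwartzMap.compSubConstCLM_apply]
    _ ≤ ∫⁻ y, ‖𝓕 (schwartzBump (scaledBump ξ₀ ε hε)) (y - x) * f y‖ₑ :=
        enorm_integral_le_lintegral_enorm _
    _ = _ := by
        refine lintegral_congr_ae ?_
        filter_upwards [hgf] with y hy
        rw [enorm_mul, hy, mul_comm, fourier_schwartzBump_scaledBump ξ₀ hε, dilatedKernel,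
          ← ofReal_norm (_ • _), norm_smul, Circle.norm_smul, Real.norm_of_nonneg (by positivity)]

end Bandlimited

lemma ofReal_rpow_mul_ofReal_rpow_neg {u : ℝ} (hu : 0 < u) (a : ℝ) :
    ENNReal.ofReal (u ^ a) * ENNReal.ofReal (u ^ (-a)) = 1 := by
  rw [← ENNReal.ofReal_mul (by positivity), ← Real.rpow_add hu, add_neg_cancel, Real.rpow_zero,
    ENNReal.ofReal_one]

lemma rpow_le_of_le_rpow_one_sub_mul {V B : ℝ≥0∞} {p : ℝ} (hp : 0 < p) (hp1 : p ≤ 1)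
    (hV : V ≠ ∞) (h : V ≤ V ^ (1 - p) * B) : V ^ p ≤ B := by
  rcases eq_or_ne V 0 with hV0 | hV0
  · rw [hV0, ENNReal.zero_rpow_of_pos hp]
    exact zero_le
  have hpow0 : V ^ (1 - p) ≠ 0 := (ENNReal.rpow_pos (pos_iff_ne_zero.2 hV0) hV).ne'
  have hpow : V ^ (1 - p) ≠ ∞ := ENNReal.rpow_ne_top_of_nonneg (sub_nonneg.2 hp1) hV
  refine (ENNReal.mul_le_mul_iff_right hpow0 hpow).1 ?_
  rwa [← ENNReal.rpow_add_of_nonneg _ _ (sub_nonneg.2 hp1) hp.le, sub_add_cancel,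
    ENNReal.rpow_one]

lemma lintegral_mul_rpow_le {α : Type*} [MeasurableSpace α] {μ : Measure α} {G k : α → ℝ≥0∞}
    (hG : AEMeasurable G μ) (hk : AEMeasurable k μ) {p : ℝ} (hp : 1 < p) :
    (∫⁻ y, G y * k y ∂μ) ^ p ≤ (∫⁻ y, G y ^ p * k y ∂μ) * (∫⁻ y, k y ∂μ) ^ (p - 1) := by
  have hpq := Real.HolderConjugate.conjExponent hp
  have hp0 : 0 < p := hpq.pos
  have hq0 : 0 < p.conjExponent := hpq.symm.pos
  have hsplit (y : α) : G y * k y = G y * k y ^ (1 / p) * k y ^ (1 / p.conjExponent) := by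
    rw [mul_assoc, ← ENNReal.rpow_add_of_nonneg _ _ (by positivity) (by positivity),
      one_div, one_div, hpq.inv_add_inv_eq_one, ENNReal.rpow_one]
  have hleft (y : α) : (G y * k y ^ (1 / p)) ^ p = G y ^ p * k y := by
    rw [ENNReal.mul_rpow_of_nonneg _ _ hp0.le, ← ENNReal.rpow_mul, one_div_mul_cancel hp0.ne',
      ENNReal.rpow_one]
  have hright (y : α) : (k y ^ (1 / p.conjExponent)) ^ p.conjExponent = k y := by
    rw [← ENNReal.rpow_mul, one_div_mul_cancel hq0.ne', ENNReal.rpow_one]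
  have hHolder := ENNReal.lintegral_mul_le_Lp_mul_Lq μ hpq (hG.mul (hk.pow_const (1 / p)))
    (hk.pow_const (1 / p.conjExponent))
  simp only [Pi.mul_apply, ← hsplit, hleft, hright] at hHolder
  calc (∫⁻ y, G y * k y ∂μ) ^ p
      ≤ ((∫⁻ y, G y ^ p * k y ∂μ) ^ (1 / p) * (∫⁻ y, k y ∂μ) ^ (1 / p.conjExponent)) ^ p :=
        ENNReal.rpow_le_rpow hHolder hp0.le
    _ = (∫⁻ y, G y ^ p * k y ∂μ) * (∫⁻ y, k y ∂μ) ^ (p - 1) := by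
        rw [ENNReal.mul_rpow_of_nonneg _ _ hp0.le, ← ENNReal.rpow_mul, ← ENNReal.rpow_mul,
          one_div_mul_cancel hp0.ne', ENNReal.rpow_one, one_div_mul_eq_div,
          hpq.div_conj_eq_sub_one]

section PeetreSup

variable {E : Type*} [SeminormedAddCommGroup E]

lemma one_add_mul_norm_sub_rpow_neg_le {ε : ℝ} (hε : 0 ≤ ε) {a : ℝ} (ha : 0 ≤ a) (x y z : E) :
    (1 + ε * ‖y - z‖) ^ (-a) ≤ (1 + ε * ‖x - z‖) ^ a * (1 + ε * ‖x - y‖) ^ (-a) := by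
  have htri : ‖x - y‖ ≤ ‖x - z‖ + ‖y - z‖ := by
    simpa only [norm_sub_rev y z] using norm_sub_le_norm_sub_add_norm_sub x z y
  have hmul : 1 + ε * ‖x - y‖ ≤ (1 + ε * ‖x - z‖) * (1 + ε * ‖y - z‖) := by
    have : 0 ≤ (ε * ‖x - z‖) * (ε * ‖y - z‖) := by positivity
    nlinarith [mul_le_mul_of_nonneg_left htri hε]
  rw [Real.rpow_neg (by positivity), Real.rpow_neg (by positivity), ← div_eq_mul_inv,
    inv_eq_one_div, div_le_div_iff₀ (by positivity) (by positivity), one_mul,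
    ← Real.mul_rpow (by positivity) (by positivity)]
  exact Real.rpow_le_rpow (by positivity) hmul ha

lemma one_add_norm_le_mul {ε : ℝ} (hε : 0 < ε) (x z : E) :
    1 + ‖z‖ ≤ (1 + ‖x‖) * (1 + ε⁻¹) * (1 + ε * ‖x - z‖) := by
  have htri : ‖z‖ ≤ ‖x‖ + ‖x - z‖ := by
    simpa only [sub_sub_cancel] using norm_sub_le x (x - z)
  have hscale : 1 + ‖x - z‖ ≤ (1 + ε⁻¹) * (1 + ε * ‖x - z‖) := by
    have hinv : 0 < ε⁻¹ := inv_pos.2 hε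
    have : 0 ≤ ε * ‖x - z‖ := by positivity
    nlinarith [inv_mul_cancel_left₀ hε.ne' ‖x - z‖]
  calc 1 + ‖z‖ ≤ (1 + ‖x‖) * (1 + ‖x - z‖) := by
        nlinarith [mul_nonneg (norm_nonneg x) (norm_nonneg (x - z))]
    _ ≤ (1 + ‖x‖) * ((1 + ε⁻¹) * (1 + ε * ‖x - z‖)) := by gcongr
    _ = _ := (mul_assoc _ _ _).symm

/-- Peetre's maximal function `sup_z G(z) (1 + ε |x - z|)⁻ᵃ` of order `a` at frequency `ε`. Unlike
`peetreMaximal` its weight is submultiplicative. -/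
noncomputable def peetreSup (ε a : ℝ) (G : E → ℝ≥0∞) (x : E) : ℝ≥0∞ :=
  ⨆ z, G z * ENNReal.ofReal ((1 + ε * ‖x - z‖) ^ (-a))

lemma le_peetreSup (ε a : ℝ) (G : E → ℝ≥0∞) (x z : E) :
    G z * ENNReal.ofReal ((1 + ε * ‖x - z‖) ^ (-a)) ≤ peetreSup ε a G x :=
  le_iSup (fun z => G z * ENNReal.ofReal ((1 + ε * ‖x - z‖) ^ (-a))) z

lemma self_le_peetreSup (ε a : ℝ) (G : E → ℝ≥0∞) (x : E) : G x ≤ peetreSup ε a G x := by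
  simpa only [sub_self, norm_zero, mul_zero, add_zero, Real.one_rpow, ENNReal.ofReal_one, mul_one]
    using le_peetreSup ε a G x x

lemma le_peetreSup_mul {ε : ℝ} (hε : 0 ≤ ε) (a : ℝ) (G : E → ℝ≥0∞) (x z : E) :
    G z ≤ peetreSup ε a G x * ENNReal.ofReal ((1 + ε * ‖x - z‖) ^ a) := by
  calc G z = G z * ENNReal.ofReal ((1 + ε * ‖x - z‖) ^ (-a)) *
        ENNReal.ofReal ((1 + ε * ‖x - z‖) ^ a) := by
        rw [mul_right_comm, mul_assoc, ofReal_rpow_mul_ofReal_rpow_neg (by positivity), mul_one]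
    _ ≤ _ := by gcongr; exact le_peetreSup ε a G x z

lemma peetreSup_rpow_le_of_forall {ε a p : ℝ} (hε : 0 ≤ ε) (hp : 0 < p) {G : E → ℝ≥0∞} {x : E}
    {B : ℝ≥0∞} (h : ∀ z, G z ^ p * ENNReal.ofReal ((1 + ε * ‖x - z‖) ^ (-(a * p))) ≤ B) :
    peetreSup ε a G x ^ p ≤ B := by
  rw [← ENNReal.le_rpow_inv_iff hp]
  refine iSup_le fun z => (ENNReal.le_rpow_inv_iff hp).2 ((le_of_eq ?_).trans (h z))
  rw [ENNReal.mul_rpow_of_nonneg _ _ hp.le, ENNReal.ofReal_rpow_of_nonneg (by positivity) hp.le,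
    ← Real.rpow_mul (by positivity), neg_mul]

lemma peetreSup_ne_top_of_growth {ε a D M : ℝ} (hε : 0 < ε) (hD : 0 ≤ D) (ha : 0 ≤ a) (hMa : M ≤ a)
    {G : E → ℝ≥0∞} (hG : ∀ x, G x ≤ ENNReal.ofReal (D * (1 + ‖x‖) ^ M)) (x : E) :
    peetreSup ε a G x ≠ ∞ := by
  set L := (1 + ‖x‖) * (1 + ε⁻¹)
  refine ne_top_of_le_ne_top (ENNReal.ofReal_ne_top (r := D * L ^ a)) (iSup_le fun z => ?_)
  have hgrowth : D * (1 + ‖z‖) ^ M ≤ D * L ^ a * (1 + ε * ‖x - z‖) ^ a := by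
    rw [mul_assoc, ← Real.mul_rpow (by positivity) (by positivity)]
    gcongr
    calc (1 + ‖z‖) ^ M ≤ (1 + ‖z‖) ^ a :=
          Real.rpow_le_rpow_of_exponent_le (le_add_of_nonneg_right (norm_nonneg z)) hMa
      _ ≤ _ := Real.rpow_le_rpow (by positivity) (one_add_norm_le_mul hε x z) ha
  calc G z * ENNReal.ofReal ((1 + ε * ‖x - z‖) ^ (-a))
      ≤ ENNReal.ofReal (D * L ^ a * (1 + ε * ‖x - z‖) ^ a) *
          ENNReal.ofReal ((1 + ε * ‖x - z‖) ^ (-a)) := by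
        gcongr
        exact (hG z).trans (ENNReal.ofReal_le_ofReal hgrowth)
    _ = ENNReal.ofReal (D * L ^ a) := by
        rw [ENNReal.ofReal_mul (by positivity), mul_assoc,
          ofReal_rpow_mul_ofReal_rpow_neg (by positivity), mul_one]

end PeetreSup

section PeetreWeight

variable {E : Type*} [NormedAddCommGroup E] [NormedSpace ℝ E]

lemma exists_norm_le_mul_one_add_norm_rpow_neg (Ψ : 𝓢(E, ℂ)) (a : ℝ) :
    ∃ C : ℝ, 0 < C ∧ ∀ v, ‖Ψ v‖ ≤ C * (1 + ‖v‖) ^ (-a) := by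
  set C := 2 ^ ⌈a⌉₊ * (Finset.Iic (⌈a⌉₊, 0)).sup (fun m => SchwartzMap.seminorm ℝ m.1 m.2) Ψ
  have hC : 0 ≤ C := mul_nonneg (by positivity) (apply_nonneg _ _)
  refine ⟨C + 1, add_pos_of_nonneg_of_pos hC one_pos, fun v => ?_⟩
  have hdecay : (1 + ‖v‖) ^ ⌈a⌉₊ * ‖Ψ v‖ ≤ C := by
    simpa only [norm_iteratedFDeriv_zero] using
      SchwartzMap.one_add_le_sup_seminorm_apply (𝕜 := ℝ) (m := (⌈a⌉₊, 0)) le_rfl le_rfl Ψ v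
  rw [Real.rpow_neg (by positivity), ← div_eq_mul_inv, le_div_iff₀ (by positivity), mul_comm]
  calc (1 + ‖v‖) ^ a * ‖Ψ v‖ ≤ (1 + ‖v‖) ^ ⌈a⌉₊ * ‖Ψ v‖ := by
        gcongr
        rw [← Real.rpow_natCast]
        exact Real.rpow_le_rpow_of_exponent_le (le_add_of_nonneg_right (norm_nonneg v))
          (Nat.le_ceil a)
    _ ≤ C + 1 := hdecay.trans (le_add_of_nonneg_right zero_le_one)

/-- The weight `εⁿ (1 + ε |v|)⁻ᵇ`, the dilation by `ε` of `(1 + |v|)⁻ᵇ`. -/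
noncomputable def peetreWeight (ε b : ℝ) (v : E) : ℝ≥0∞ :=
  ENNReal.ofReal (ε ^ Module.finrank ℝ E * (1 + ε * ‖v‖) ^ (-b))

lemma dilatedKernel_mul_le {Ψ : 𝓢(E, ℂ)} {C b : ℝ} (hb : 0 ≤ b) (hC : 0 ≤ C)
    (hΨ : ∀ v, ‖Ψ v‖ ≤ C * (1 + ‖v‖) ^ (-b)) {ε : ℝ} (hε : 0 ≤ ε) (x y z : E) :
    dilatedKernel Ψ ε (y - z) * ENNReal.ofReal ((1 + ε * ‖x - z‖) ^ (-b)) ≤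
      ENNReal.ofReal C * peetreWeight ε b (x - y) := by
  have hu : 0 < 1 + ε * ‖x - z‖ := by positivity
  have hΨy : ‖Ψ (ε • (y - z))‖ ≤
      C * ((1 + ε * ‖x - z‖) ^ b * (1 + ε * ‖x - y‖) ^ (-b)) := by
    refine (hΨ _).trans ?_
    rw [norm_smul, Real.norm_of_nonneg hε]
    exact mul_le_mul_of_nonneg_left (one_add_mul_norm_sub_rpow_neg_le hε hb x y z) hC
  rw [dilatedKernel, peetreWeight, ← ENNReal.ofReal_mul (by positivity), ← ENNReal.ofReal_mul hC]
  refine ENNReal.ofReal_le_ofReal ?_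
  calc ε ^ Module.finrank ℝ E * ‖Ψ (ε • (y - z))‖ * (1 + ε * ‖x - z‖) ^ (-b)
      ≤ ε ^ Module.finrank ℝ E * (C * ((1 + ε * ‖x - z‖) ^ b * (1 + ε * ‖x - y‖) ^ (-b))) *
          (1 + ε * ‖x - z‖) ^ (-b) := by gcongr
    _ = C * (ε ^ Module.finrank ℝ E * (1 + ε * ‖x - y‖) ^ (-b)) *
          ((1 + ε * ‖x - z‖) ^ b * (1 + ε * ‖x - z‖) ^ (-b)) := by ring
    _ = _ := by rw [← Real.rpow_add hu, add_neg_cancel, Real.rpow_zero, mul_one]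

lemma mul_peetreWeight_le {ε a p : ℝ} (hε : 0 ≤ ε) (hp : 0 ≤ p) (hp1 : p ≤ 1)
    (G : E → ℝ≥0∞) (x y : E) :
    G y * peetreWeight ε a (x - y) ≤
      peetreSup ε a G x ^ (1 - p) * (G y ^ p * peetreWeight ε (a * p) (x - y)) := by
  have hu : 0 < 1 + ε * ‖x - y‖ := by positivity
  have hexp : (1 + ε * ‖x - y‖) ^ (a * (1 - p)) * (1 + ε * ‖x - y‖) ^ (-a) =
      (1 + ε * ‖x - y‖) ^ (-(a * p)) := by
    rw [← Real.rpow_add hu]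
    ring_nf
  have hG : G y ^ (1 - p) ≤
      peetreSup ε a G x ^ (1 - p) * ENNReal.ofReal ((1 + ε * ‖x - y‖) ^ (a * (1 - p))) := by
    rw [Real.rpow_mul hu.le, ← ENNReal.ofReal_rpow_of_nonneg (by positivity) (sub_nonneg.2 hp1),
      ← ENNReal.mul_rpow_of_nonneg _ _ (sub_nonneg.2 hp1)]
    exact ENNReal.rpow_le_rpow (le_peetreSup_mul hε a G x y) (sub_nonneg.2 hp1)
  calc G y * peetreWeight ε a (x - y)
      = G y ^ p * G y ^ (1 - p) * peetreWeight ε a (x - y) := by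
        rw [← ENNReal.rpow_add_of_nonneg _ _ hp (sub_nonneg.2 hp1), add_sub_cancel,
          ENNReal.rpow_one]
    _ ≤ G y ^ p * (peetreSup ε a G x ^ (1 - p) *
          ENNReal.ofReal ((1 + ε * ‖x - y‖) ^ (a * (1 - p)))) * peetreWeight ε a (x - y) := by
        gcongr
    _ = peetreSup ε a G x ^ (1 - p) * (G y ^ p *
          (ENNReal.ofReal ((1 + ε * ‖x - y‖) ^ (a * (1 - p))) * peetreWeight ε a (x - y))) := by
        ring
    _ = _ := by
        rw [peetreWeight, peetreWeight, ← ENNReal.ofReal_mul (by positivity),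
          mul_left_comm ((1 + ε * ‖x - y‖) ^ (a * (1 - p))), hexp, mul_left_comm]

end PeetreWeight

section PeetreEstimate

variable {E : Type*} [NormedAddCommGroup E] [InnerProductSpace ℝ E] [FiniteDimensional ℝ E]
  [MeasurableSpace E] [BorelSpace E]

lemma lintegral_dilatedKernel_sub (Ψ : 𝓢(E, ℂ)) {ε : ℝ} (hε : 0 < ε) (z : E) :
    ∫⁻ y, dilatedKernel Ψ ε (y - z) = ENNReal.ofReal (∫ y, ‖Ψ y‖) := by
  have hint : Integrable fun y => ‖Ψ (ε • (y - z))‖ :=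
    ((Ψ.integrable (μ := volume)).norm.comp_smul hε.ne').comp_sub_right z
  simp only [dilatedKernel]
  rw [← ofReal_integral_eq_lintegral_ofReal (hint.const_mul _)
    (Eventually.of_forall fun y => by positivity), integral_const_mul,
    integral_sub_right_eq_self (fun y => ‖Ψ (ε • y)‖) z,
    Measure.integral_comp_smul_of_nonneg _ (fun y => ‖Ψ y‖) ε (hR := hε.le), smul_eq_mul,
    mul_inv_cancel_left₀ (by positivity)]

/-- The integral `∫ H(z) εⁿ (1 + ε |x - z|)⁻ᵇ dz`, the mean of `H` at scale `ε⁻¹` about `x`. -/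
noncomputable def peetreIntegral (ε b : ℝ) (H : E → ℝ≥0∞) (x : E) : ℝ≥0∞ :=
  ∫⁻ z, H z * peetreWeight ε b (x - z)

lemma peetreIntegral_le_mul {ε b b' : ℝ} (hε : 0 ≤ ε) (hb : 0 ≤ b) (hbb' : b ≤ b')
    (H : E → ℝ≥0∞) (x z : E) :
    peetreIntegral ε b' H z ≤
      ENNReal.ofReal ((1 + ε * ‖x - z‖) ^ b) * peetreIntegral ε b H x := by
  rw [peetreIntegral, peetreIntegral, ← lintegral_const_mul' _ _ ENNReal.ofReal_ne_top]
  refine lintegral_mono fun w => ?_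
  have hweight : (1 + ε * ‖z - w‖) ^ (-b') ≤
      (1 + ε * ‖x - z‖) ^ b * (1 + ε * ‖x - w‖) ^ (-b) := by
    refine le_trans ?_ (one_add_mul_norm_sub_rpow_neg_le hε hb x w z)
    rw [norm_sub_rev]
    exact Real.rpow_le_rpow_of_exponent_le (le_add_of_nonneg_right (by positivity))
      (neg_le_neg hbb')
  rw [mul_left_comm, peetreWeight, peetreWeight, ← ENNReal.ofReal_mul (by positivity),
    mul_left_comm]
  gcongr

lemma exists_peetreSup_rpow_le_of_le_one (Ψ : 𝓢(E, ℂ)) {p a : ℝ} (hp : 0 < p) (hp1 : p ≤ 1)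
    (ha : 0 ≤ a) :
    ∃ C : ℝ, 0 < C ∧ ∀ ε : ℝ, 0 ≤ ε → ∀ G : E → ℝ≥0∞,
      (∀ x, G x ≤ ∫⁻ y, G y * dilatedKernel Ψ ε (y - x)) →
      ∀ x, peetreSup ε a G x ≠ ∞ → peetreSup ε a G x ^ p ≤
        ENNReal.ofReal C * peetreIntegral ε (a * p) (fun z => G z ^ p) x := by
  obtain ⟨C, hC, hΨ⟩ := exists_norm_le_mul_one_add_norm_rpow_neg Ψ a
  refine ⟨C, hC, fun ε hε G hrep x hfin =>
    rpow_le_of_le_rpow_one_sub_mul hp hp1 hfin (iSup_le fun z => ?_)⟩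
  have hpow : peetreSup ε a G x ^ (1 - p) ≠ ∞ :=
    ENNReal.rpow_ne_top_of_nonneg (sub_nonneg.2 hp1) hfin
  calc G z * ENNReal.ofReal ((1 + ε * ‖x - z‖) ^ (-a))
      ≤ (∫⁻ y, G y * dilatedKernel Ψ ε (y - z)) * ENNReal.ofReal ((1 + ε * ‖x - z‖) ^ (-a)) := by
        gcongr
        exact hrep z
    _ = ∫⁻ y, G y * (dilatedKernel Ψ ε (y - z) * ENNReal.ofReal ((1 + ε * ‖x - z‖) ^ (-a))) := by
        rw [← lintegral_mul_const' _ _ ENNReal.ofReal_ne_top]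
        simp only [mul_assoc]
    _ ≤ ∫⁻ y, ENNReal.ofReal C * (G y * peetreWeight ε a (x - y)) :=
        lintegral_mono fun y => (mul_le_mul_right (dilatedKernel_mul_le ha hC.le hΨ hε x y z)
          _).trans_eq (mul_left_comm _ _ _)
    _ ≤ ∫⁻ y, ENNReal.ofReal C * (peetreSup ε a G x ^ (1 - p) *
          (G y ^ p * peetreWeight ε (a * p) (x - y))) :=
        lintegral_mono fun y => mul_le_mul_right (mul_peetreWeight_le hε hp.le hp1 G x y) _
    _ = peetreSup ε a G x ^ (1 - p) *
          (ENNReal.ofReal C * peetreIntegral ε (a * p) (fun z => G z ^ p) x) := by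
        rw [lintegral_const_mul' _ _ ENNReal.ofReal_ne_top, lintegral_const_mul' _ _ hpow,
          mul_left_comm, peetreIntegral]

lemma exists_peetreSup_rpow_le_of_one_lt (Ψ : 𝓢(E, ℂ)) {p a : ℝ} (hp : 1 < p) (ha : 0 ≤ a) :
    ∃ C : ℝ, 0 < C ∧ ∀ ε : ℝ, 0 < ε → ∀ G : E → ℝ≥0∞, AEMeasurable G →
      (∀ x, G x ≤ ∫⁻ y, G y * dilatedKernel Ψ ε (y - x)) →
      ∀ x, peetreSup ε a G x ^ p ≤
        ENNReal.ofReal C * peetreIntegral ε (a * p) (fun z => G z ^ p) x := by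
  have hp0 : 0 < p := one_pos.trans hp
  obtain ⟨C, hC, hΨ⟩ := exists_norm_le_mul_one_add_norm_rpow_neg Ψ (a * p)
  set J := (∫ y, ‖Ψ y‖) + 1
  have hJ : 0 < J := add_pos_of_nonneg_of_pos (integral_nonneg fun y => norm_nonneg _) one_pos
  refine ⟨J ^ (p - 1) * C, mul_pos (Real.rpow_pos_of_pos hJ _) hC, fun ε hε G hG hrep x =>
    peetreSup_rpow_le_of_forall hε.le hp0 fun z => ?_⟩
  have hmeas : Measurable fun y => dilatedKernel Ψ ε (y - z) :=
    (continuous_const.mul (Ψ.continuous.comp (by fun_prop)).norm).measurable.ennreal_ofReal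
  have hGz : G z ^ p ≤
      (∫⁻ y, G y ^ p * dilatedKernel Ψ ε (y - z)) * ENNReal.ofReal J ^ (p - 1) := by
    refine (ENNReal.rpow_le_rpow (hrep z) hp0.le).trans
      ((lintegral_mul_rpow_le hG hmeas.aemeasurable hp).trans ?_)
    rw [lintegral_dilatedKernel_sub Ψ hε z]
    gcongr
    exact le_add_of_nonneg_right zero_le_one
  calc G z ^ p * ENNReal.ofReal ((1 + ε * ‖x - z‖) ^ (-(a * p)))
      ≤ (∫⁻ y, G y ^ p * dilatedKernel Ψ ε (y - z)) * ENNReal.ofReal J ^ (p - 1) *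
          ENNReal.ofReal ((1 + ε * ‖x - z‖) ^ (-(a * p))) := by gcongr
    _ = ENNReal.ofReal J ^ (p - 1) * ∫⁻ y, G y ^ p * (dilatedKernel Ψ ε (y - z) *
          ENNReal.ofReal ((1 + ε * ‖x - z‖) ^ (-(a * p)))) := by
        simp only [← mul_assoc (G _ ^ p)]
        rw [lintegral_mul_const' _ _ ENNReal.ofReal_ne_top]
        ring
    _ ≤ ENNReal.ofReal J ^ (p - 1) * ∫⁻ y, ENNReal.ofReal C *
          (G y ^ p * peetreWeight ε (a * p) (x - y)) := by
        refine mul_le_mul_right (lintegral_mono fun y => ?_) _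
        exact (mul_le_mul_right (dilatedKernel_mul_le (by positivity) hC.le hΨ hε.le x y z)
          _).trans_eq (mul_left_comm _ _ _)
    _ = _ := by
        rw [lintegral_const_mul' _ _ ENNReal.ofReal_ne_top, ENNReal.ofReal_mul (by positivity),
          ENNReal.ofReal_rpow_of_nonneg (by positivity) (by linarith), mul_assoc, peetreIntegral]

lemma exists_peetreSup_rpow_le_of_ne_top (Ψ : 𝓢(E, ℂ)) {p a : ℝ} (hp : 0 < p) (ha : 0 ≤ a) :
    ∃ C : ℝ, 0 < C ∧ ∀ ε : ℝ, 0 < ε → ∀ G : E → ℝ≥0∞, AEMeasurable G →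
      (∀ x, G x ≤ ∫⁻ y, G y * dilatedKernel Ψ ε (y - x)) →
      ∀ x, peetreSup ε a G x ≠ ∞ → peetreSup ε a G x ^ p ≤
        ENNReal.ofReal C * peetreIntegral ε (a * p) (fun z => G z ^ p) x := by
  rcases le_or_gt p 1 with hp1 | hp1
  · obtain ⟨C, hC, h⟩ := exists_peetreSup_rpow_le_of_le_one Ψ hp hp1 ha
    exact ⟨C, hC, fun ε hε G _ => h ε hε.le G⟩
  · obtain ⟨C, hC, h⟩ := exists_peetreSup_rpow_le_of_one_lt Ψ hp1 ha
    exact ⟨C, hC, fun ε hε G hG hrep x _ => h ε hε G hG hrep x⟩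

-- For a large order the maximal function is finite by the growth bound, and the estimate at that
-- order shows that it is finite at order `a` as well.
theorem exists_peetreSup_rpow_le (Ψ : 𝓢(E, ℂ)) {p a : ℝ} (hp : 0 < p) (ha : 0 ≤ a) :
    ∃ C : ℝ, 0 < C ∧ ∀ ε : ℝ, 0 < ε → ∀ G : E → ℝ≥0∞, AEMeasurable G →
      (∀ x, G x ≤ ∫⁻ y, G y * dilatedKernel Ψ ε (y - x)) →
      (∃ D M : ℝ, 0 ≤ D ∧ ∀ x, G x ≤ ENNReal.ofReal (D * (1 + ‖x‖) ^ M)) →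
      ∀ x, peetreSup ε a G x ^ p ≤
        ENNReal.ofReal C * peetreIntegral ε (a * p) (fun z => G z ^ p) x := by
  obtain ⟨C, hC, hpeetre⟩ := exists_peetreSup_rpow_le_of_ne_top Ψ hp ha
  refine ⟨C, hC, fun ε hε G hG hrep ⟨D, M, hD, hgrowth⟩ x => ?_⟩
  set I := peetreIntegral ε (a * p) (fun z => G z ^ p) x
  rcases eq_or_ne I ∞ with hI | hI
  · rw [hI, ENNReal.mul_top (ENNReal.ofReal_pos.2 hC).ne']
    exact le_top
  have ha' : 0 ≤ max a M := le_max_of_le_left ha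
  obtain ⟨C', -, hpeetre'⟩ := exists_peetreSup_rpow_le_of_ne_top Ψ hp ha'
  have hG' (z : E) : G z ^ p ≤
      ENNReal.ofReal C' * (ENNReal.ofReal ((1 + ε * ‖x - z‖) ^ (a * p)) * I) :=
    calc G z ^ p ≤ peetreSup ε (max a M) G z ^ p :=
          ENNReal.rpow_le_rpow (self_le_peetreSup _ _ G z) hp.le
      _ ≤ ENNReal.ofReal C' * peetreIntegral ε (max a M * p) (fun z => G z ^ p) z :=
          hpeetre' ε hε G hG hrep z
            (peetreSup_ne_top_of_growth hε hD ha' (le_max_right a M) hgrowth z)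
      _ ≤ _ := by
          gcongr
          exact peetreIntegral_le_mul hε.le (by positivity)
            (mul_le_mul_of_nonneg_right (le_max_left a M) hp.le) _ x z
  have hfin : peetreSup ε a G x ^ p ≤ ENNReal.ofReal C' * I := by
    refine peetreSup_rpow_le_of_forall hε.le hp fun z => ?_
    calc G z ^ p * ENNReal.ofReal ((1 + ε * ‖x - z‖) ^ (-(a * p)))
        ≤ ENNReal.ofReal C' * (ENNReal.ofReal ((1 + ε * ‖x - z‖) ^ (a * p)) * I) *
            ENNReal.ofReal ((1 + ε * ‖x - z‖) ^ (-(a * p))) := by gcongr; exact hG' z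
      _ = ENNReal.ofReal C' * I * (ENNReal.ofReal ((1 + ε * ‖x - z‖) ^ (a * p)) *
            ENNReal.ofReal ((1 + ε * ‖x - z‖) ^ (-(a * p)))) := by ring
      _ = ENNReal.ofReal C' * I := by
          rw [ofReal_rpow_mul_ofReal_rpow_neg (by positivity), mul_one]
  refine hpeetre ε hε G hG hrep x fun htop => ?_
  rw [htop, ENNReal.top_rpow_of_pos hp] at hfin
  exact ENNReal.mul_ne_top ENNReal.ofReal_ne_top hI (top_le_iff.1 hfin)

end PeetreEstimate

section Cubes

lemma exists_le_two_pow_le {s : ℝ} (hs : 0 ≤ s) :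
    ∃ k : ℕ, s ≤ 2 ^ k ∧ 2 ^ k ≤ 2 * (1 + s) := by
  obtain ⟨k, hk, hk'⟩ := exists_nat_pow_near (le_add_of_nonneg_right hs) one_lt_two
  exact ⟨k + 1, by linarith, by rw [pow_succ']; linarith⟩

lemma ofReal_one_add_rpow_neg_le_tsum {b : ℝ} (hb : 0 ≤ b) {s : ℝ} (hs : 0 ≤ s) :
    ENNReal.ofReal ((1 + s) ^ (-b)) ≤
      ∑' k : ℕ, ENNReal.ofReal (2 ^ b * (2 ^ (-b)) ^ k) * (if s ≤ 2 ^ k then 1 else 0) := by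
  obtain ⟨k, hsk, hks⟩ := exists_le_two_pow_le hs
  refine le_trans ?_ (ENNReal.le_tsum k)
  rw [if_pos hsk, mul_one]
  apply ENNReal.ofReal_le_ofReal
  calc (1 + s) ^ (-b) ≤ (2 ^ k / 2) ^ (-b) :=
        Real.rpow_le_rpow_of_nonpos (by positivity) (by linarith) (neg_nonpos.2 hb)
    _ = 2 ^ b * (2 ^ (-b)) ^ k := by
        rw [Real.div_rpow (by positivity) zero_le_two, ← Real.rpow_natCast, ← Real.rpow_natCast,
          ← Real.rpow_mul zero_le_two, ← Real.rpow_mul zero_le_two,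
          Real.rpow_neg (y := b) zero_le_two, div_inv_eq_mul, mul_comm, mul_comm (-b)]

variable {n : ℕ}

lemma mem_axisCube_comm {c z : RSpace n} {ℓ : ℝ} : z ∈ axisCube c ℓ ↔ c ∈ axisCube z ℓ := by
  simp only [axisCube, Set.mem_ofPred_eq, abs_sub_comm]

lemma axisCube_mono {c : RSpace n} {ℓ ℓ' : ℝ} (h : ℓ ≤ ℓ') : axisCube c ℓ ⊆ axisCube c ℓ' :=
  fun _ hy i => (hy i).trans (by linarith)

lemma axisCube_subset_of_mem {c u : RSpace n} {t h : ℝ} (hu : u ∈ axisCube c t) :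
    axisCube u h ⊆ axisCube c (t + h) := fun y hy i => by
  have htri := abs_sub_le (y i) (u i) (c i)
  have hyu := hy i
  have huc := hu i
  linarith

lemma mem_axisCube_of_norm_sub_le {u z : RSpace n} {s : ℝ} (h : ‖u - z‖ ≤ s) :
    z ∈ axisCube u (2 * s) := fun i => by
  have hi := PiLp.norm_apply_le (u - z) i
  rw [PiLp.sub_apply, Real.norm_eq_abs, abs_sub_comm] at hi
  linarith

lemma isClosed_mem_axisCube (h : ℝ) :
    IsClosed {q : RSpace n × RSpace n | q.2 ∈ axisCube q.1 h} := by
  have heq : {q : RSpace n × RSpace n | q.2 ∈ axisCube q.1 h} =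
      ⋂ i, {q | |q.2 i - q.1 i| ≤ h / 2} := by
    ext q
    simp only [axisCube, Set.mem_ofPred_eq, Set.mem_iInter]
  rw [heq]
  exact isClosed_iInter fun i => isClosed_le (by fun_prop) continuous_const

lemma measurableSet_axisCube (c : RSpace n) (ℓ : ℝ) : MeasurableSet (axisCube c ℓ) :=
  ((isClosed_mem_axisCube ℓ).preimage (Continuous.prodMk_right c)).measurableSet

lemma volume_axisCube (c : RSpace n) (ℓ : ℝ) : volume (axisCube c ℓ) = ENNReal.ofReal ℓ ^ n := by
  have hpre : axisCube c ℓ = (WithLp.ofLp : RSpace n → Fin n → ℝ) ⁻¹'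
      Set.Icc (fun i => c i - ℓ / 2) (fun i => c i + ℓ / 2) := by
    ext y
    simp only [axisCube, Set.mem_ofPred_eq, Set.mem_preimage, Set.mem_Icc, Pi.le_def,
      ← forall_and, abs_sub_le_iff, sub_le_iff_le_add, add_comm, and_comm]
  rw [hpre,
    (PiLp.volume_preserving_ofLp (Fin n)).measure_preimage measurableSet_Icc.nullMeasurableSet,
    Real.volume_Icc_pi]
  simp only [add_sub_sub_cancel, add_halves, Finset.prod_const, Finset.card_univ, Fintype.card_fin]

/-- The integral of `H` over cubes of side `h`, as a function of the centre. -/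
noncomputable def cubeIntegral (h : ℝ) (H : RSpace n → ℝ≥0∞) (u : RSpace n) : ℝ≥0∞ :=
  ∫⁻ z in axisCube u h, H z

lemma cubeIntegral_eq_lintegral_indicator (h : ℝ) (H : RSpace n → ℝ≥0∞) (u : RSpace n) :
    cubeIntegral h H u = ∫⁻ z, (axisCube u h).indicator H z :=
  (lintegral_indicator (measurableSet_axisCube u h) H).symm

lemma measurable_indicator_axisCube (h : ℝ) {H : RSpace n → ℝ≥0∞} (hH : Measurable H) :
    Measurable fun q : RSpace n × RSpace n => (axisCube q.1 h).indicator H q.2 :=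
  (hH.comp measurable_snd).indicator (isClosed_mem_axisCube h).measurableSet

lemma measurable_cubeIntegral (h : ℝ) {H : RSpace n → ℝ≥0∞} (hH : Measurable H) :
    Measurable (cubeIntegral h H) := by
  simpa only [← cubeIntegral_eq_lintegral_indicator] using
    (measurable_indicator_axisCube h hH).lintegral_prod_right' (ν := volume)

lemma lintegral_indicator_axisCube_le {x z : RSpace n} {t h : ℝ} (H : RSpace n → ℝ≥0∞) :
    ∫⁻ u in axisCube x t, (axisCube u h).indicator H z ≤
      (axisCube x (t + h)).indicator (fun z => H z * ENNReal.ofReal h ^ n) z := by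
  by_cases hz : z ∈ axisCube x (t + h)
  · rw [Set.indicator_of_mem hz, ← volume_axisCube z h, ← setLIntegral_const,
      ← lintegral_indicator (measurableSet_axisCube z h)]
    refine (setLIntegral_le_lintegral _ _).trans (lintegral_mono fun u => ?_)
    by_cases hu : z ∈ axisCube u h
    · rw [Set.indicator_of_mem hu, Set.indicator_of_mem (mem_axisCube_comm.1 hu)]
    · rw [Set.indicator_of_notMem hu]
      exact zero_le
  · rw [Set.indicator_of_notMem hz, nonpos_iff_eq_zero]
    exact setLIntegral_eq_zero (measurableSet_axisCube x t) fun u hu =>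
      Set.indicator_of_notMem (fun hzu => hz (axisCube_subset_of_mem hu hzu)) _

lemma setLIntegral_cubeIntegral_le_setLIntegral {H : RSpace n → ℝ≥0∞} (hH : Measurable H)
    (x : RSpace n) (t h : ℝ) :
    ∫⁻ u in axisCube x t, cubeIntegral h H u ≤
      (∫⁻ z in axisCube x (t + h), H z) * ENNReal.ofReal h ^ n := by
  calc ∫⁻ u in axisCube x t, cubeIntegral h H u
      = ∫⁻ u in axisCube x t, ∫⁻ z, (axisCube u h).indicator H z := by
        simp only [cubeIntegral_eq_lintegral_indicator]
    _ = ∫⁻ z, ∫⁻ u in axisCube x t, (axisCube u h).indicator H z :=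
        lintegral_lintegral_swap (measurable_indicator_axisCube h hH).aemeasurable
    _ ≤ ∫⁻ z, (axisCube x (t + h)).indicator (fun z => H z * ENNReal.ofReal h ^ n) z :=
        lintegral_mono fun z => lintegral_indicator_axisCube_le H
    _ = _ := by
        rw [lintegral_indicator (measurableSet_axisCube x _),
          lintegral_mul_const' _ _ (by finiteness)]

lemma setLIntegral_cubeIntegral_le_volume_mul (H : RSpace n → ℝ≥0∞) (x : RSpace n) (t h : ℝ) :
    ∫⁻ u in axisCube x t, cubeIntegral h H u ≤
      (∫⁻ z in axisCube x (t + h), H z) * ENNReal.ofReal t ^ n := by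
  rw [← volume_axisCube x t, ← setLIntegral_const]
  exact setLIntegral_mono' (measurableSet_axisCube x t) fun u hu =>
    lintegral_mono_set (axisCube_subset_of_mem hu)

lemma setLIntegral_cubeIntegral_le {H : RSpace n → ℝ≥0∞} (hH : Measurable H) {x : RSpace n}
    {t h : ℝ} (hh : 0 < h) {S : ℝ≥0∞}
    (hS : ∀ τ, t < τ → ∫⁻ z in axisCube x τ, H z ≤ ENNReal.ofReal τ ^ n * S) :
    ∫⁻ u in axisCube x t, cubeIntegral h H u ≤
      2 ^ n * ENNReal.ofReal t ^ n * ENNReal.ofReal h ^ n * S := by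
  have htwo (s : ℝ) : ENNReal.ofReal (2 * s) ^ n = 2 ^ n * ENNReal.ofReal s ^ n := by
    rw [ENNReal.ofReal_mul zero_le_two, mul_pow, ENNReal.ofReal_ofNat]
  have hcube (s : ℝ) (hs : t + h ≤ 2 * s) : ∫⁻ z in axisCube x (t + h), H z ≤
      2 ^ n * ENNReal.ofReal s ^ n * S := by
    rw [← htwo]
    refine (hS (t + h) (by linarith)).trans ?_
    gcongr
  rcases le_or_gt h t with hht | hth
  · refine (setLIntegral_cubeIntegral_le_setLIntegral hH x t h).trans ?_
    calc _ ≤ 2 ^ n * ENNReal.ofReal t ^ n * S * ENNReal.ofReal h ^ n := by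
          gcongr; exact hcube t (by linarith)
      _ = _ := by ring
  · refine (setLIntegral_cubeIntegral_le_volume_mul H x t h).trans ?_
    calc _ ≤ 2 ^ n * ENNReal.ofReal h ^ n * S * ENNReal.ofReal t ^ n := by
          gcongr; exact hcube h (by linarith)
      _ = _ := by ring

lemma mul_peetreWeight_le_tsum_indicator (H : RSpace n → ℝ≥0∞) {ε b : ℝ} (hε : 0 < ε) (hb : 0 ≤ b)
    (u z : RSpace n) :
    H z * peetreWeight ε b (u - z) ≤ ∑' k : ℕ, ENNReal.ofReal (ε ^ n * (2 ^ b * (2 ^ (-b)) ^ k)) *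
      (axisCube u (2 * (2 ^ k / ε))).indicator H z := by
  rw [peetreWeight, finrank_euclideanSpace_fin, ENNReal.ofReal_mul (by positivity)]
  calc H z * (ENNReal.ofReal (ε ^ n) * ENNReal.ofReal ((1 + ε * ‖u - z‖) ^ (-b)))
      ≤ H z * (ENNReal.ofReal (ε ^ n) * ∑' k : ℕ, ENNReal.ofReal (2 ^ b * (2 ^ (-b)) ^ k) *
          (if ε * ‖u - z‖ ≤ 2 ^ k then 1 else 0)) := by
        gcongr
        exact ofReal_one_add_rpow_neg_le_tsum hb (by positivity)
    _ = ∑' k : ℕ, ENNReal.ofReal (ε ^ n * (2 ^ b * (2 ^ (-b)) ^ k)) *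
          (H z * (if ε * ‖u - z‖ ≤ 2 ^ k then 1 else 0)) := by
        rw [← ENNReal.tsum_mul_left, ← ENNReal.tsum_mul_left]
        refine tsum_congr fun k => ?_
        rw [ENNReal.ofReal_mul (p := ε ^ n) (by positivity)]
        ring
    _ ≤ _ := by
        refine ENNReal.tsum_le_tsum fun k => mul_le_mul_right ?_ _
        split_ifs with hk
        · rw [Set.indicator_of_mem, mul_one]
          refine mem_axisCube_of_norm_sub_le ?_
          rwa [le_div_iff₀ hε, mul_comm]
        · rw [mul_zero]
          exact zero_le

lemma peetreIntegral_le_tsum {H : RSpace n → ℝ≥0∞} (hH : Measurable H) {ε b : ℝ} (hε : 0 < ε)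
    (hb : 0 ≤ b) (u : RSpace n) :
    peetreIntegral ε b H u ≤ ∑' k : ℕ, ENNReal.ofReal (ε ^ n * (2 ^ b * (2 ^ (-b)) ^ k)) *
      cubeIntegral (2 * (2 ^ k / ε)) H u := by
  refine (lintegral_mono (mul_peetreWeight_le_tsum_indicator H hε hb u)).trans_eq ?_
  rw [lintegral_tsum fun k =>
    ((hH.indicator (measurableSet_axisCube u _)).const_mul _).aemeasurable]
  refine tsum_congr fun k => ?_
  rw [lintegral_const_mul' _ _ ENNReal.ofReal_ne_top, cubeIntegral_eq_lintegral_indicator]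

lemma ofReal_dyadic_weight_mul (n : ℕ) {ε : ℝ} (hε : 0 < ε) (b : ℝ) (k : ℕ) :
    ENNReal.ofReal (ε ^ n * (2 ^ b * (2 ^ (-b)) ^ k)) * 2 ^ n *
        ENNReal.ofReal (2 * (2 ^ k / ε)) ^ n =
      ENNReal.ofReal (2 ^ b * 4 ^ n * (2 ^ ((n : ℝ) - b)) ^ k) := by
  have hratio : (2 : ℝ) ^ ((n : ℝ) - b) = 2 ^ n * 2 ^ (-b) := by
    rw [sub_eq_add_neg, Real.rpow_add two_pos, Real.rpow_natCast]
  have hreal : ε ^ n * (2 ^ b * (2 ^ (-b)) ^ k) * 2 ^ n * (2 * (2 ^ k / ε)) ^ n =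
      2 ^ b * 4 ^ n * (2 ^ ((n : ℝ) - b)) ^ k := by
    rw [hratio, mul_pow, mul_pow, div_pow, ← pow_mul, ← pow_mul, mul_comm n k,
      show (4 : ℝ) = 2 * 2 by norm_num, mul_pow]
    field_simp
  rw [← hreal, ENNReal.ofReal_mul (q := (2 * (2 ^ k / ε)) ^ n) (by positivity),
    ENNReal.ofReal_mul (q := 2 ^ n) (by positivity),
    ENNReal.ofReal_pow (p := 2 * (2 ^ k / ε)) (by positivity),
    ENNReal.ofReal_pow (p := 2) zero_le_two, ENNReal.ofReal_ofNat]

theorem exists_setLIntegral_peetreIntegral_le {b : ℝ} (hb : (n : ℝ) < b) :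
    ∃ C : ℝ, 0 < C ∧ ∀ ε : ℝ, 0 < ε → ∀ H : RSpace n → ℝ≥0∞, Measurable H →
      ∀ (x : RSpace n) (t : ℝ) (S : ℝ≥0∞),
      (∀ τ, t < τ → ∫⁻ z in axisCube x τ, H z ≤ ENNReal.ofReal τ ^ n * S) →
      ∫⁻ u in axisCube x t, peetreIntegral ε b H u ≤
        ENNReal.ofReal C * ENNReal.ofReal t ^ n * S := by
  have hb0 : 0 ≤ b := (Nat.cast_nonneg n).trans hb.le
  let w (ε : ℝ) (k : ℕ) : ℝ≥0∞ := ENNReal.ofReal (ε ^ n * (2 ^ b * (2 ^ (-b)) ^ k))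
  have hsum : Summable fun k : ℕ => 2 ^ b * 4 ^ n * ((2 : ℝ) ^ ((n : ℝ) - b)) ^ k :=
    (summable_geometric_of_lt_one (by positivity)
      (Real.rpow_lt_one_of_one_lt_of_neg one_lt_two (sub_neg.2 hb))).mul_left _
  refine ⟨∑' k : ℕ, 2 ^ b * 4 ^ n * (2 ^ ((n : ℝ) - b)) ^ k,
    hsum.tsum_pos (fun k => by positivity) 0 (by positivity), fun ε hε H hH x t S hS => ?_⟩
  calc ∫⁻ u in axisCube x t, peetreIntegral ε b H u
      ≤ ∫⁻ u in axisCube x t, ∑' k : ℕ, w ε k * cubeIntegral (2 * (2 ^ k / ε)) H u :=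
        lintegral_mono fun u => peetreIntegral_le_tsum hH hε hb0 u
    _ = ∑' k : ℕ, w ε k * ∫⁻ u in axisCube x t, cubeIntegral (2 * (2 ^ k / ε)) H u := by
        rw [lintegral_tsum fun k => ((measurable_cubeIntegral _ hH).const_mul _).aemeasurable]
        exact tsum_congr fun k => lintegral_const_mul' _ _ ENNReal.ofReal_ne_top
    _ ≤ ∑' k : ℕ, w ε k *
          (2 ^ n * ENNReal.ofReal t ^ n * ENNReal.ofReal (2 * (2 ^ k / ε)) ^ n * S) :=
        ENNReal.tsum_le_tsum fun k =>
          mul_le_mul_right (setLIntegral_cubeIntegral_le hH (by positivity) hS) _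
    _ = ∑' k : ℕ, ENNReal.ofReal (2 ^ b * 4 ^ n * (2 ^ ((n : ℝ) - b)) ^ k) *
          (ENNReal.ofReal t ^ n * S) := by
        refine tsum_congr fun k => ?_
        rw [← ofReal_dyadic_weight_mul n hε]
        ring
    _ = _ := by
        rw [ENNReal.tsum_mul_right, ← ENNReal.ofReal_tsum_of_nonneg (fun k => by positivity) hsum,
          ← mul_assoc]

end Cubes

section Morrey

variable {n : ℕ} {p : ℝ}

lemma morreyNorm_le_iff (hp : 0 < p) {φ : RSpace n → ℝ → ℝ} (hφ : ∀ x t, 0 < t → 0 < φ x t)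
    {h : RSpace n → ℝ≥0∞} {M : ℝ≥0∞} :
    morreyNorm p φ h ≤ M ↔ ∀ c ℓ, 0 < ℓ →
      ∫⁻ y in axisCube c ℓ, h y ^ p ≤ ENNReal.ofReal ℓ ^ n * (M * ENNReal.ofReal (φ c ℓ)) ^ p := by
  simp only [morreyNorm, iSup_le_iff]
  refine forall₃_congr fun c ℓ hℓ => ?_
  have hφ0 : ENNReal.ofReal (φ c ℓ) ≠ 0 := (ENNReal.ofReal_pos.2 (hφ c ℓ hℓ)).ne'
  have hvol0 : ENNReal.ofReal ℓ ^ n ≠ 0 := pow_ne_zero n (ENNReal.ofReal_pos.2 hℓ).ne'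
  rw [ENNReal.div_le_iff hφ0 ENNReal.ofReal_ne_top, one_div, ENNReal.rpow_inv_le_iff hp,
    volume_axisCube, ENNReal.div_le_iff hvol0 (by finiteness), mul_comm]

lemma ofReal_rpow_div_rpow (hp : 0 < p) {s : ℝ} (hs : 0 ≤ s) :
    ENNReal.ofReal (s ^ ((n : ℝ) / p)) ^ p = ENNReal.ofReal s ^ n := by
  rw [ENNReal.ofReal_rpow_of_nonneg (by positivity) hp.le, ← Real.rpow_mul hs,
    div_mul_cancel₀ _ hp.ne', Real.rpow_natCast, ENNReal.ofReal_pow hs]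

lemma mul_le_mul_of_iInf_mul_le {w : ℝ → ℝ≥0∞} {τ : ℝ} {J M c κ : ℝ≥0∞} (hκ : κ ≠ 0)
    (hw : (⨅ (s : ℝ) (_ : τ < s), w s) * c ≤ κ) (hJ : ∀ s, τ < s → J ≤ M * w s) :
    J * c ≤ M * κ := by
  rcases eq_or_ne M 0 with rfl | hM0
  · have hJ0 := hJ (τ + 1) (lt_add_one τ)
    rw [zero_mul, nonpos_iff_eq_zero] at hJ0
    rw [hJ0, zero_mul]
    exact zero_le
  rcases eq_or_ne M ∞ with rfl | hMtop
  · rw [ENNReal.top_mul hκ]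
    exact le_top
  calc J * c = M * (J / M * c) := by rw [← mul_assoc, ENNReal.mul_div_cancel hM0 hMtop]
    _ ≤ M * ((⨅ (s : ℝ) (_ : τ < s), w s) * c) := by
        gcongr
        exact le_iInf₂ fun s hs => ENNReal.div_le_of_le_mul' (hJ s hs)
    _ ≤ M * κ := by gcongr

lemma setLIntegral_le_of_iSup_iInf_le (hp : 0 < p) {φ : RSpace n → ℝ → ℝ}
    (hφ : ∀ x t, 0 < t → 0 < φ x t) {x : RSpace n} {t : ℝ} (ht : 0 ≤ t) {κ : ℝ≥0∞} (hκ : κ ≠ 0)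
    (h_sup : (⨆ (τ : ℝ) (_ : t < τ),
      (⨅ (s : ℝ) (_ : τ < s), ENNReal.ofReal (φ x s * s ^ ((n : ℝ) / p))) *
        ENNReal.ofReal (τ ^ (-((n : ℝ) / p)))) ≤ κ)
    (h : RSpace n → ℝ≥0∞) {τ : ℝ} (hτ : t < τ) :
    ∫⁻ y in axisCube x τ, h y ^ p ≤ ENNReal.ofReal τ ^ n * (morreyNorm p φ h * κ) ^ p := by
  have hτ0 : 0 < τ := ht.trans_lt hτ
  have hlarger (s : ℝ) (hs : τ < s) : (∫⁻ y in axisCube x τ, h y ^ p) ^ p⁻¹ ≤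
      morreyNorm p φ h * ENNReal.ofReal (φ x s * s ^ ((n : ℝ) / p)) := by
    have hs0 : 0 < s := hτ0.trans hs
    rw [ENNReal.rpow_inv_le_iff hp, ENNReal.ofReal_mul (hφ x s hs0).le, ← mul_assoc,
      ENNReal.mul_rpow_of_nonneg _ _ hp.le, ofReal_rpow_div_rpow hp hs0.le, mul_comm]
    exact (lintegral_mono_set (axisCube_mono hs.le)).trans
      ((morreyNorm_le_iff hp hφ).1 le_rfl x s hs0)
  have hroot : (∫⁻ y in axisCube x τ, h y ^ p) ^ p⁻¹ * ENNReal.ofReal (τ ^ (-((n : ℝ) / p))) ≤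
      morreyNorm p φ h * κ :=
    mul_le_mul_of_iInf_mul_le hκ ((le_iSup₂_of_le τ hτ le_rfl).trans h_sup) hlarger
  have hscale : ENNReal.ofReal (τ ^ (-((n : ℝ) / p))) * ENNReal.ofReal (τ ^ ((n : ℝ) / p)) = 1 := by
    rw [← ENNReal.ofReal_mul (by positivity), ← Real.rpow_add hτ0, neg_add_cancel, Real.rpow_zero,
      ENNReal.ofReal_one]
  rw [← ofReal_rpow_div_rpow hp hτ0.le, ← ENNReal.mul_rpow_of_nonneg _ _ hp.le,
    ← ENNReal.rpow_inv_le_iff hp, mul_comm]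
  calc (∫⁻ y in axisCube x τ, h y ^ p) ^ p⁻¹
      = (∫⁻ y in axisCube x τ, h y ^ p) ^ p⁻¹ * ENNReal.ofReal (τ ^ (-((n : ℝ) / p))) *
          ENNReal.ofReal (τ ^ ((n : ℝ) / p)) := by rw [mul_assoc, hscale, mul_one]
    _ ≤ _ := by gcongr

lemma morreyNorm_congr_ae {φ : RSpace n → ℝ → ℝ} {h h' : RSpace n → ℝ≥0∞}
    (hh : h =ᵐ[volume] h') : morreyNorm p φ h = morreyNorm p φ h' := by
  have hint (c : RSpace n) (ℓ : ℝ) :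
      ∫⁻ y in axisCube c ℓ, h y ^ p = ∫⁻ y in axisCube c ℓ, h' y ^ p :=
    lintegral_congr_ae (ae_restrict_of_ae (hh.fun_comp (· ^ p)))
  simp only [morreyNorm, hint]

lemma littleLqNorm_le_of_forall_le {q : ℝ≥0∞} (hq : 0 < q) {a b : ℕ → ℝ≥0∞} {c : ℝ≥0∞}
    (h : ∀ j, a j ≤ c * b j) : littleLqNorm q a ≤ c * littleLqNorm q b := by
  unfold littleLqNorm
  split_ifs with hqt
  · rw [ENNReal.mul_iSup]
    exact iSup_mono h
  · have hq0 : 0 < q.toReal := ENNReal.toReal_pos hq.ne' hqt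
    calc (∑' j, a j ^ q.toReal) ^ (1 / q.toReal)
        ≤ (∑' j, c ^ q.toReal * b j ^ q.toReal) ^ (1 / q.toReal) := by
          gcongr with j
          rw [← ENNReal.mul_rpow_of_nonneg _ _ hq0.le]
          exact ENNReal.rpow_le_rpow (h j) hq0.le
      _ = _ := by
          rw [ENNReal.tsum_mul_left, ENNReal.mul_rpow_of_nonneg _ _ (by positivity),
            ← ENNReal.rpow_mul, mul_one_div_cancel hq0.ne', ENNReal.rpow_one]

end Morrey

section PeetreMaximal

lemma inv_one_add_rpow_le {a s : ℝ} (ha : 0 ≤ a) (hs : 0 ≤ s) :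
    (1 + s ^ a)⁻¹ ≤ 2 ^ a * (1 + s) ^ (-a) := by
  have hpow : (1 + s) ^ a ≤ 2 ^ a * (1 + s ^ a) := by
    have hsa : 0 ≤ s ^ a := by positivity
    rcases le_total s 1 with h | h
    · calc (1 + s) ^ a ≤ 2 ^ a := Real.rpow_le_rpow (by positivity) (by linarith) ha
        _ ≤ _ := le_mul_of_one_le_right (by positivity) (by linarith)
    · calc (1 + s) ^ a ≤ (2 * s) ^ a := Real.rpow_le_rpow (by positivity) (by linarith) ha
        _ = 2 ^ a * s ^ a := Real.mul_rpow zero_le_two hs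
        _ ≤ _ := by gcongr; linarith
  rw [Real.rpow_neg (by positivity), ← div_eq_mul_inv, le_div_iff₀ (by positivity),
    inv_mul_le_iff₀ (by positivity), mul_comm]
  exact hpow

lemma exists_subset_closedBall_diam {X : Type*} [PseudoMetricSpace X] [Nonempty X] {s : Set X}
    (hs : Bornology.IsBounded s) : ∃ x, s ⊆ Metric.closedBall x (Metric.diam s) := by
  rcases s.eq_empty_or_nonempty with rfl | ⟨x, hx⟩
  · exact ⟨Classical.arbitrary X, Set.empty_subset _⟩
  · exact ⟨x, fun y hy => Metric.dist_le_diam_of_mem hs hy hx⟩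

variable {n : ℕ} {r : ℝ}

lemma le_peetreMaximal (r d : ℝ) (g : RSpace n → ℂ) (x y : RSpace n) :
    ‖g (x - y)‖ₑ / ENNReal.ofReal (1 + (d * ‖y‖) ^ ((n : ℝ) / r)) ≤ peetreMaximal r d g x :=
  le_iSup (fun y => ‖g (x - y)‖ₑ / ENNReal.ofReal (1 + (d * ‖y‖) ^ ((n : ℝ) / r))) y

lemma peetreMaximal_anti (hr : 0 ≤ r) {d d' : ℝ} (hd : 0 ≤ d) (hdd' : d ≤ d') (g : RSpace n → ℂ)
    (x : RSpace n) : peetreMaximal r d' g x ≤ peetreMaximal r d g x := by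
  refine iSup_mono fun y => ?_
  gcongr

lemma measurable_peetreMaximal {d : ℝ} (hd : 0 ≤ d) {g : RSpace n → ℂ}
    (hg : Continuous g) : Measurable (peetreMaximal r d g) := by
  refine (lowerSemicontinuous_iSup fun y => Continuous.lowerSemicontinuous ?_).measurable
  have hpos : 0 < 1 + (d * ‖y‖) ^ ((n : ℝ) / r) := by positivity
  exact (ENNReal.continuous_div_const _ (ENNReal.ofReal_pos.2 hpos).ne').comp
    (hg.comp (by fun_prop)).enorm

lemma peetreMaximal_le_peetreSup (hr : 0 ≤ r) {ε : ℝ} (hε : 0 ≤ ε) (g : RSpace n → ℂ)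
    (x : RSpace n) :
    peetreMaximal r ε g x ≤ ENNReal.ofReal (2 ^ ((n : ℝ) / r)) *
      peetreSup ε ((n : ℝ) / r) (fun z => ‖g z‖ₑ) x := by
  refine iSup_le fun y => ?_
  have hsup := le_peetreSup ε ((n : ℝ) / r) (fun z => ‖g z‖ₑ) x (x - y)
  rw [sub_sub_cancel] at hsup
  refine le_trans ?_ (mul_le_mul_right hsup _)
  rw [div_eq_mul_inv, ← ENNReal.ofReal_inv_of_pos (by positivity), mul_left_comm,
    ← ENNReal.ofReal_mul (by positivity)]
  gcongr
  exact inv_one_add_rpow_le (by positivity) (by positivity)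

lemma peetreMaximal_le_iSup_of_tendsto (hr : 0 ≤ r) {ι : Type*} {l : Filter ι} [NeBot l]
    {e : ι → ℝ} {d : ℝ} (he : Tendsto e l (𝓝 d)) (g : RSpace n → ℂ) (x : RSpace n) :
    peetreMaximal r d g x ≤ ⨆ i, peetreMaximal r (e i) g x := by
  refine iSup_le fun y => ?_
  have hden : Tendsto (fun i => 1 + (e i * ‖y‖) ^ ((n : ℝ) / r)) l
      (𝓝 (1 + (d * ‖y‖) ^ ((n : ℝ) / r))) :=
    ((he.mul_const _).rpow_const (Or.inr (by positivity))).const_add _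
  exact le_of_tendsto'
    (ENNReal.Tendsto.const_div (ENNReal.tendsto_ofReal hden) (Or.inr enorm_ne_top))
    fun i => (le_peetreMaximal r (e i) g x y).trans (le_iSup (fun i => peetreMaximal r (e i) g x) i)

lemma setLIntegral_peetreMaximal_le_of_forall_gt (hr : 0 ≤ r) {p d : ℝ} (hp : 0 < p) (hd : 0 ≤ d)
    {g : RSpace n → ℂ} (hg : Continuous g) {s : Set (RSpace n)} {B : ℝ≥0∞}
    (h : ∀ ε, d < ε → ∫⁻ x in s, peetreMaximal r ε g x ^ p ≤ B) :
    ∫⁻ x in s, peetreMaximal r d g x ^ p ≤ B := by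
  obtain ⟨e, hanti, he, hlim⟩ := exists_seq_strictAnti_tendsto d
  have he0 (k : ℕ) : 0 ≤ e k := hd.trans (he k).le
  calc ∫⁻ x in s, peetreMaximal r d g x ^ p
      ≤ ∫⁻ x in s, (⨆ k, peetreMaximal r (e k) g x) ^ p := lintegral_mono fun x =>
        ENNReal.rpow_le_rpow (peetreMaximal_le_iSup_of_tendsto hr hlim g x) hp.le
    _ = ∫⁻ x in s, ⨆ k, peetreMaximal r (e k) g x ^ p :=
        lintegral_congr fun x => (ENNReal.orderIsoRpow p hp).map_iSup _
    _ = ⨆ k, ∫⁻ x in s, peetreMaximal r (e k) g x ^ p :=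
        lintegral_iSup (fun k => (measurable_peetreMaximal (he0 k) hg).pow_const p)
          fun k l hkl x => ENNReal.rpow_le_rpow
            (peetreMaximal_anti hr (he0 l) (hanti.antitone hkl) g x) hp.le
    _ ≤ B := iSup_le fun k => h _ (he k)

lemma exists_peetreMaximal_rpow_le (Ψ : 𝓢(RSpace n, ℂ)) {p : ℝ} (hp : 0 < p) (hr : 0 ≤ r) :
    ∃ C : ℝ, 0 < C ∧ ∀ ε : ℝ, 0 < ε → ∀ g : RSpace n → ℂ, Continuous g →
      (∀ x, ‖g x‖ₑ ≤ ∫⁻ y, ‖g y‖ₑ * dilatedKernel Ψ ε (y - x)) →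
      (∃ D M : ℝ, 0 ≤ D ∧ ∀ x, ‖g x‖ ≤ D * (1 + ‖x‖) ^ M) →
      ∀ x, peetreMaximal r ε g x ^ p ≤
        ENNReal.ofReal C * peetreIntegral ε (n / r * p) (fun z => ‖g z‖ₑ ^ p) x := by
  obtain ⟨C, hC0, hC⟩ := exists_peetreSup_rpow_le Ψ hp (a := n / r) (by positivity)
  refine ⟨(2 ^ ((n : ℝ) / r)) ^ p * C, by positivity,
    fun ε hε g hg hrep ⟨D, M, hD, hgrowth⟩ x => ?_⟩
  calc peetreMaximal r ε g x ^ p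
      ≤ (ENNReal.ofReal (2 ^ ((n : ℝ) / r)) * peetreSup ε (n / r) (fun z => ‖g z‖ₑ) x) ^ p :=
        ENNReal.rpow_le_rpow (peetreMaximal_le_peetreSup hr hε.le g x) hp.le
    _ = ENNReal.ofReal ((2 ^ ((n : ℝ) / r)) ^ p) * peetreSup ε (n / r) (fun z => ‖g z‖ₑ) x ^ p := by
        rw [ENNReal.mul_rpow_of_nonneg _ _ hp.le,
          ENNReal.ofReal_rpow_of_nonneg (by positivity) hp.le]
    _ ≤ ENNReal.ofReal ((2 ^ ((n : ℝ) / r)) ^ p) * (ENNReal.ofReal C *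
          peetreIntegral ε (n / r * p) (fun z => ‖g z‖ₑ ^ p) x) := by
        gcongr
        exact hC ε hε _ hg.enorm.aemeasurable hrep ⟨D, M, hD, fun y =>
          (ofReal_norm (g y)).symm.trans_le (ENNReal.ofReal_le_ofReal (hgrowth y))⟩ x
    _ = _ := by rw [ENNReal.ofReal_mul (by positivity), mul_assoc]

theorem exists_setLIntegral_peetreMaximal_le {p : ℝ} (hn : 0 < n) (hr : 0 < r) (hrp : r < p) :
    ∃ C : ℝ, 0 < C ∧ ∀ Ω : Set (RSpace n), Bornology.IsBounded Ω → ∀ f : RSpace n → ℂ,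
      FourierSupportedIn f Ω → ∃ g : RSpace n → ℂ, (Continuous g ∧ g =ᵐ[volume] f) ∧
        ∀ (x : RSpace n) (t : ℝ) (S : ℝ≥0∞),
          (∀ τ, t < τ → ∫⁻ y in axisCube x τ, ‖g y‖ₑ ^ p ≤ ENNReal.ofReal τ ^ n * S) →
          ∫⁻ y in axisCube x t, peetreMaximal r (Metric.diam Ω) g y ^ p ≤
            ENNReal.ofReal C * ENNReal.ofReal t ^ n * S := by
  have hp : 0 < p := hr.trans hrp
  have hb : (n : ℝ) < n / r * p := by
    rw [div_mul_eq_mul_div, lt_div_iff₀ hr]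
    exact mul_lt_mul_of_pos_left hrp (Nat.cast_pos.2 hn)
  obtain ⟨C₁, hC₁0, hC₁⟩ := exists_peetreMaximal_rpow_le
    (𝓕 (schwartzBump (scaledBump (0 : RSpace n) 1 one_pos))) hp hr.le
  obtain ⟨C₂, hC₂0, hC₂⟩ := exists_setLIntegral_peetreIntegral_le hb
  refine ⟨C₁ * C₂, by positivity, fun Ω hΩ f ⟨T, hT, hTΩ⟩ => ?_⟩
  obtain ⟨g, hg, hgf, ⟨D, M, hD, hgrowth⟩, hrep⟩ := exists_continuous_representative hΩ hT hTΩ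
  obtain ⟨ξ₀, hξ₀⟩ := exists_subset_closedBall_diam hΩ
  refine ⟨g, ⟨hg, hgf⟩, fun x t S hS =>
    setLIntegral_peetreMaximal_le_of_forall_gt hr.le hp Metric.diam_nonneg hg fun ε hε => ?_⟩
  have hε0 : 0 < ε := Metric.diam_nonneg.trans_lt hε
  have hrepε := hrep ξ₀ ε hε0 (hξ₀.trans (Metric.closedBall_subset_closedBall hε.le))
  calc ∫⁻ y in axisCube x t, peetreMaximal r ε g y ^ p
      ≤ ∫⁻ y in axisCube x t, ENNReal.ofReal C₁ *
          peetreIntegral ε (n / r * p) (fun z => ‖g z‖ₑ ^ p) y :=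
        lintegral_mono (hC₁ ε hε0 g hg hrepε ⟨D, M, hD, hgrowth⟩)
    _ = ENNReal.ofReal C₁ * ∫⁻ y in axisCube x t,
          peetreIntegral ε (n / r * p) (fun z => ‖g z‖ₑ ^ p) y :=
        lintegral_const_mul' _ _ ENNReal.ofReal_ne_top
    _ ≤ ENNReal.ofReal C₁ * (ENNReal.ofReal C₂ * ENNReal.ofReal t ^ n * S) := by
        gcongr
        exact hC₂ ε hε0 _ (hg.enorm.measurable.pow_const p) x t S hS
    _ = _ := by
        rw [ENNReal.ofReal_mul hC₁0.le]
        ring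

theorem exists_morreyNorm_peetreMaximal_le {p : ℝ} (hn : 0 < n) (hr : 0 < r) (hrp : r < p)
    {φ₁ φ₂ : RSpace n → ℝ → ℝ} (hφ₁ : ∀ x t, 0 < t → 0 < φ₁ x t)
    (hφ₂ : ∀ x t, 0 < t → 0 < φ₂ x t) (hφ : MorreyPairCondition n p φ₁ φ₂) :
    ∃ C : ℝ, 0 < C ∧ ∀ Ω : Set (RSpace n), Bornology.IsBounded Ω → ∀ f : RSpace n → ℂ,
      FourierSupportedIn f Ω → ∃ g : RSpace n → ℂ, (Continuous g ∧ g =ᵐ[volume] f) ∧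
        morreyNorm p φ₂ (peetreMaximal r (Metric.diam Ω) g) ≤
          ENNReal.ofReal C * morreyNorm p φ₁ (fun x => ‖f x‖ₑ) := by
  have hp : 0 < p := hr.trans hrp
  obtain ⟨K, hK0, hK⟩ := hφ
  obtain ⟨C, hC0, hC⟩ := exists_setLIntegral_peetreMaximal_le hn hr hrp
  refine ⟨C ^ p⁻¹ * K, by positivity, fun Ω hΩ f hf => ?_⟩
  obtain ⟨g, ⟨hg, hgf⟩, hle⟩ := hC Ω hΩ f hf
  refine ⟨g, ⟨hg, hgf⟩, ?_⟩
  have hnorm : morreyNorm p φ₁ (fun x => ‖g x‖ₑ) = morreyNorm p φ₁ (fun x => ‖f x‖ₑ) :=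
    morreyNorm_congr_ae (hgf.fun_comp (‖·‖ₑ))
  rw [← hnorm, morreyNorm_le_iff hp hφ₂]
  intro c ℓ hℓ
  have hκ : ENNReal.ofReal (K * φ₂ c ℓ) ≠ 0 :=
    (ENNReal.ofReal_pos.2 (mul_pos hK0 (hφ₂ c ℓ hℓ))).ne'
  refine (hle c ℓ _ fun τ hτ =>
    setLIntegral_le_of_iSup_iInf_le hp hφ₁ hℓ.le hκ (hK c ℓ hℓ) _ hτ).trans_eq ?_
  have hroot : ENNReal.ofReal C = ENNReal.ofReal (C ^ p⁻¹) ^ p := by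
    rw [ENNReal.ofReal_rpow_of_nonneg (by positivity) hp.le, ← Real.rpow_mul hC0.le,
      inv_mul_cancel₀ hp.ne', Real.rpow_one]
  rw [hroot, mul_right_comm, ← ENNReal.mul_rpow_of_nonneg _ _ hp.le, mul_comm,
    ENNReal.ofReal_mul hK0.le, ENNReal.ofReal_mul (by positivity)]
  congr 2
  ring

end PeetreMaximal

theorem mainTheorem10_general (n : ℕ) (hn : 0 < n) (p r : ℝ) (q : ℝ≥0∞)
    (hq : 0 < q) (hr : 0 < r) (hrp : r < p)
    (φ₁ φ₂ : RSpace n → ℝ → ℝ)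
    (hφ₁ : ∀ x t, 0 < t → 0 < φ₁ x t) (hφ₂ : ∀ x t, 0 < t → 0 < φ₂ x t)
    (hφ : MorreyPairCondition n p φ₁ φ₂)
    (Ω : ℕ → Set (RSpace n)) (hΩ : ∀ j, Bornology.IsBounded (Ω j)) :
    ∃ C : ℝ, 0 < C ∧ ∀ f : ℕ → RSpace n → ℂ, (∀ j, FourierSupportedIn (f j) (Ω j)) →
      ∃ g : ℕ → RSpace n → ℂ,
        (∀ j, Continuous (g j) ∧ g j =ᵐ[volume] f j) ∧
        littleLqNorm q
            (fun j => morreyNorm p φ₂ (peetreMaximal r (Metric.diam (Ω j)) (g j))) ≤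
          ENNReal.ofReal C *
            littleLqNorm q (fun j => morreyNorm p φ₁ (fun x => ‖f j x‖ₑ)) := by
  obtain ⟨C, hC0, hC⟩ := exists_morreyNorm_peetreMaximal_le hn hr hrp hφ₁ hφ₂ hφ
  refine ⟨C, hC0, fun f hf => ?_⟩
  choose g hg hle using fun j => hC (Ω j) (hΩ j) (f j) (hf j)
  exact ⟨g, hg, littleLqNorm_le_of_forall_le hq hle⟩

theorem mainTheorem10 (n : ℕ) (hn : 0 < n) (p r : ℝ) (q : ℝ≥0∞)
    (hp : 0 < p) (hq : 0 < q) (hr : 0 < r)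
    (hrpq : ENNReal.ofReal r < min (ENNReal.ofReal p) q)
    (φ₁ φ₂ : RSpace n → ℝ → ℝ)
    (hφ₁ : ∀ x t, 0 < t → 0 < φ₁ x t) (hφ₂ : ∀ x t, 0 < t → 0 < φ₂ x t)
    (hφ : MorreyPairCondition n p φ₁ φ₂)
    (Ω : ℕ → Set (RSpace n)) (hΩ : ∀ j, IsCompact (Ω j)) :
    ∃ C : ℝ, 0 < C ∧ ∀ f : ℕ → RSpace n → ℂ, (∀ j, FourierSupportedIn (f j) (Ω j)) →
      ∃ g : ℕ → RSpace n → ℂ,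
        (∀ j, Continuous (g j) ∧ g j =ᵐ[volume] f j) ∧
        littleLqNorm q
            (fun j => morreyNorm p φ₂ (peetreMaximal r (Metric.diam (Ω j)) (g j))) ≤
          ENNReal.ofReal C *
            littleLqNorm q (fun j => morreyNorm p φ₁ (fun x => ‖f j x‖ₑ)) :=
  mainTheorem10_general n hn p r q hq hr
    ((ENNReal.ofReal_lt_ofReal_iff hp).1 (hrpq.trans_le (min_le_left _ _))) φ₁ φ₂ hφ₁ hφ₂ hφ Ω
    fun j => (hΩ j).isBounded
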